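/- Let $X$ be a finite set of $n$ elements, let $\ell,z\ge 1$ be integers, and let $\mathcal M=\{M_i=(X_i,\mathcal I_i)\}_{i=1}^s$ be an $\ell$-matchoid on $X$: a family of matroids with $X_i\subseteq X$ such that every $e\in X$ lies in at most $\ell$ of the $X_i$. Call $S\subseteq X$ feasible if $S\cap X_i\in\mathcal I_i$ for all $i$, and assume that $\{e\}$ is feasible for every $e\in X$. Let $f:2^X\to\mathbb Z_{\ge 0}$ be an unweighted coverage function, i.e. $f(S)=|\bigcup_{e\in S}P(e)|$ for some subsets $P(e)$ of a finite universe; $f$ is available only through a value oracle, and the matroids through independence oracles. Write $f(x\mid S)=f(S\cup\{x\})-f(S)$. The elements of $X$ arrive one by one, in an arbitrary order, each together with the indices $i$ such that $e\in X_i$. For a set $T$ of elements, $\mathrm{RepSet}(T)$ is the output of $\mathrm{Guess}((\emptyset,\dots,\emptyset),T)$, where $\mathrm{Guess}((J_1,\dots,J_s),Y)$ returns $\emptyset$ if $Y=\emptyset$, and otherwise takes the element $e$ of $Y$ that arrived first and returns $\{e\}$, united, if $\sum_i|J_i|<(z-1)\ell$, with the outputs of $\mathrm{Guess}((J_1,\dots,J_i\cup\{e\},\dots,J_s),\,Y\setminus\mathrm{span}_{M_i}(J_i\cup\{e\}))$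 over all $i$ with $e\in X_i$. The algorithm StreamingCoverage keeps $z-1$ rooted trees with roots $\mathbf n_1,\dots,\mathbf n_{z-1}$. Each node $\mathbf n$ stores $z$ sets $R_1,\dots,R_z$ (initially empty), with union $\mathrm{AllReps}(\mathbf n)$, and has a parent element, which is a dummy element $\bot$ covering no points if $\mathbf n$ is a root, and an element stored at the parent node otherwise. When $e$ arrives: if $f(\{e\})\ge z$, stop and output $R=\{e\}$; if $f(\{e\})=0$, discard $e$; otherwise start at the node $\mathbf n=\mathbf n_{f(\{e\})}$ and search as follows. Let $p$ be the parent element of $\mathbf n$. If $f(e\mid p)=f(e\mid\{r,p\})$ for all $r\in\mathrm{AllReps}(\mathbf n)$, the search ends at $\mathbf n$. Otherwise take the first $r$ for which this fails; if some child $\mathbf n'$ of $\mathbf n$ with parent element $r$ satisfies $f(r\mid r')=f(r\mid e)=f(r\mid\{r',e\})$ for all $r'\in\mathrm{AllReps}(\mathbf n')$, continue from the first such $\mathbf n'$; if there is none, create a new child of $\mathbf n$ with parent element $r$, and the search ends there. At the node where the search ends, for $j=1,\dots,z$ replace $R_j$ by $\mathrm{RepSet}(R_j\cup\{e\})$, stopping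 as soon as the new $R_j$ contains $e$. After the last arrival, output the set $R$ of all elements stored in the trees. Put $$N_{1,z}=2^{(z-1)^2}z^{2z+1},\qquad N_{\ell,z}=2^{(z-1)^2}\,\ell^{\,z(z-1)\ell}\,z^{z+1}\quad(\ell>1).$$ There is an absolute constant $C$ such that in every case the following hold. 1. For every $T\subseteq X$, $\mathrm{RepSet}(T)$ is a joint $z$-representative set for $T$, $\mathcal M$ and every weight function $w:X\to\mathbb R$ that is strictly decreasing on $T$ in the order of arrival: $\mathrm{RepSet}(T)\subseteq T$, and for every feasible $B$ with $|B|\le z$ and every $b\in T\cap B$ there is $e\in\mathrm{RepSet}(T)$ with $w(e)\ge w(b)$ such that $(B\setminus\{b\})\cup\{e\}$ is feasible. 2. The output $R$ of StreamingCoverage is a kernel for finding a feasible set of value at least $z$: if some feasible $O\subseteq X$ has $f(O)\ge z$, then some feasible $S\subseteq R$ has $f(S)\ge z$ and $|S|\le z$. 3. $|R|\le C\,N_{\ell,z}$. 4. If $n\ge 2$ and $s\le n\ell$, the algorithm stores at most $C\,N_{\ell,z}\log_2 n$ bits at any time, where an element is written in $\lceil\log_2 n\rceil$ bits and an index of a matroid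 in $\lceil\log_2 s\rceil$ bits. 5. The algorithm makes at most $C\,N_{\ell,z}\,n$ value queries to $f$. -/

import Mathlib

/-! ### Matchoids, coverage functions, kernels, joint representative sets -/

/-- A family of matroids `M i` with ground sets `(M i).E ⊆ X` is an `ℓ`-matchoid if every element
lies in at most `ℓ` of the ground sets. -/
def IsMatchoid {X ι : Type} (ℓ : ℕ) (M : ι → Matroid X) : Prop :=
  ∀ e : X, {i | e ∈ (M i).E}.encard ≤ ℓ

/-- `S` is feasible if `S ∩ X_i` is independent in `M i` for all `i`. -/
def Feasible {X ι : Type} (M : ι → Matroid X) (S : Finset X) : Prop :=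
  ∀ i, (M i).Indep (↑S ∩ (M i).E)

/-- `f S` is the number of points of a finite universe `U` covered by the sets `P e`, `e ∈ S`. -/
def IsUnweightedCoverage {X : Type} (f : Finset X → ℕ) : Prop :=
  ∃ (U : Type) (_ : Fintype U) (_ : DecidableEq U) (P : X → Finset U),
    ∀ S : Finset X, f S = (S.biUnion P).card

/-- `R` is a kernel for finding a feasible set of value at least `z`: if there is such a set at
all, then there is one inside `R`; moreover one with at most `z` elements. -/
def IsKernel {X ι : Type} (M : ι → Matroid X) (f : Finset X → ℕ) (z : ℕ) (R : Finset X) : Prop :=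
  (∃ O : Finset X, Feasible M O ∧ z ≤ f O) →
    ∃ S : Finset X, S ⊆ R ∧ Feasible M S ∧ z ≤ f S ∧ S.card ≤ z

/-- `R` is a joint `k`-representative set for `(T, M, w)`. -/
def IsJointRepSet {X ι : Type} [DecidableEq X] (M : ι → Matroid X) (k : ℕ) (T : Finset X)
    (w : X → ℝ) (R : Finset X) : Prop :=
  R ⊆ T ∧ ∀ B : Finset X, Feasible M B → B.card ≤ k → ∀ b ∈ T ∩ B,
    ∃ e ∈ R, w b ≤ w e ∧ Feasible M (insert e (B.erase b))

/-! ### Programs with oracles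

A program has access to the objective only through `value` and to the matroids only through
`indep`. The instruction `hold m p` runs `p` while `m` further bits (the live variables of the
caller) are kept in memory. -/

inductive OProg (X ι : Type) : Type → Type 1
  | pure {β : Type} (b : β) : OProg X ι β
  | bind {β γ : Type} (p : OProg X ι γ) (k : γ → OProg X ι β) : OProg X ι β
  | value (S : Finset X) : OProg X ι ℕ
  | indep (i : ι) (S : Finset X) : OProg X ι Bool
  | hold {β : Type} (m : ℕ) (p : OProg X ι β) : OProg X ι β

namespace OProg

instance instMonad (X ι : Type) : Monad (OProg X ι) where
  pure := OProg.pure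
  bind := OProg.bind

variable {X ι : Type}

/-- The result of a program, for the value oracle `f` and the independence oracles `I`. -/
def eval (f : Finset X → ℕ) (I : ι → Finset X → Bool) : {β : Type} → OProg X ι β → β
  | _, .pure b => b
  | _, .bind p k => eval f I (k (eval f I p))
  | _, .value S => f S
  | _, .indep i S => I i S
  | _, .hold _ p => eval f I p

/-- The number of value queries that a program makes. -/
def valueQueries (f : Finset X → ℕ) (I : ι → Finset X → Bool) : {β : Type} → OProg X ι β → ℕ
  | _, .pure _ => 0
  | _, .bind p k => valueQueries f I p + valueQueries f I (k (eval f I p))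
  | _, .value _ => 1
  | _, .indep _ _ => 0
  | _, .hold _ p => valueQueries f I p

/-- The maximum, over the whole execution, of the number of bits in memory. -/
def peakBits (f : Finset X → ℕ) (I : ι → Finset X → Bool) : {β : Type} → OProg X ι β → ℕ
  | _, .pure _ => 0
  | _, .bind p k => max (peakBits f I p) (peakBits f I (k (eval f I p)))
  | _, .value _ => 0
  | _, .indep _ _ => 0
  | _, .hold m p => m + peakBits f I p

end OProg

/-! ### The streaming algorithm -/

namespace Coverage

/-- What the algorithm is given: the parameters `z` and `ℓ`, for each element `e` the list
`grounds e` of the indices `i` with `e ∈ X_i` (which arrives together with `e`), and the number of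
bits in which an element and an index are written; these two only serve to count memory. -/
structure Setup (X ι : Type) where
  z : ℕ
  ℓ : ℕ
  grounds : X → List ι
  elemBits : ℕ
  indexBits : ℕ

variable {X ι : Type} [DecidableEq X] [DecidableEq ι]

/-- For an independent set `T` of the `i`-th matroid, `Y` without the elements spanned by `T`:
those elements of `X_i` that lie in `T` or whose addition to `T` destroys independence. -/
def notSpanned (A : Setup X ι) (i : ι) (T : Finset X) : List X → OProg X ι (List X)
  | [] => pure []
  | y :: Y => do
    let keep ←
      if i ∈ A.grounds y then
        if y ∈ T then pure false else OProg.indep i (insert y T)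
      else pure true
    let Y' ← notSpanned A i T Y
    pure (if keep then y :: Y' else Y')

/-- The component `J_i` of a multi-dimensional set, given as the list of its pairs `(i, e)`. -/
def component (J : List (ι × X)) (i : ι) : Finset X :=
  ((J.filter fun q => q.1 = i).map Prod.snd).toFinset

/-- `Guess(J, Y)` with `d = (k - 1) ℓ - ‖J‖` levels of recursion left. The elements of `Y` are
listed by decreasing weight, that is, in order of arrival; the element of maximum weight is the
first one. The caller keeps `J` and `Y` in memory. -/
def guess (A : Setup X ι) : ℕ → List (ι × X) → List X → OProg X ι (Finset X)
  | _, _, [] => pure ∅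
  | 0, _, e :: _ => OProg.hold A.elemBits (pure {e})
  | d + 1, J, e :: Y =>
    (A.grounds e).foldlM (fun R i => do
      let Yi ← OProg.hold ((R.card + (Y.length + 1) + (J.length + 1)) * A.elemBits + A.indexBits)
        (notSpanned A i (insert e (component J i)) (e :: Y))
      let R' ← OProg.hold ((R.card + Yi.length + 1) * A.elemBits + A.indexBits)
        (guess A d ((i, e) :: J) Yi)
      OProg.hold ((R.card + R'.card) * A.elemBits) (pure (R ∪ R'))) {e}

/-- `RepSet(T)` with parameter `k = z`, for `T` listed in order of arrival. -/
def repSet (A : Setup X ι) (T : List X) : OProg X ι (Finset X) :=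
  guess A ((A.z - 1) * A.ℓ) [] T

/-- A list of sibling nodes. Every node has an associated element `parent` of the node above it,
the sets `R_1, …, R_z` (each listed in order of arrival), and its list of children. -/
inductive Forest (X : Type) : Type
  | nil : Forest X
  | cons (parent : X) (sets : List (List X)) (children siblings : Forest X) : Forest X

/-- A tree; its root has the dummy parent element, which covers no points. -/
structure Tree (X : Type) : Type where
  sets : List (List X)
  children : Forest X

/-- All elements stored in a forest. -/
def Forest.elems : Forest X → Finset X
  | .nil => ∅
  | .cons _ sets ch sib => sets.flatten.toFinset ∪ ch.elems ∪ sib.elems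

/-- All elements stored in a tree. -/
def Tree.elems (t : Tree X) : Finset X := t.sets.flatten.toFinset ∪ t.children.elems

/-- Bits of the sets at a node: every element is preceded by one bit, and one bit ends a set. -/
def setsBits (b : ℕ) (sets : List (List X)) : ℕ :=
  (sets.map fun R => R.length * (b + 1) + 1).sum

/-- Bits of a forest: one bit tells whether a node follows; a node is stored by its parent
element, its sets and its children. -/
def Forest.bits (b : ℕ) : Forest X → ℕ
  | .nil => 1
  | .cons _ sets ch sib => 1 + b + setsBits b sets + ch.bits b + sib.bits b

def Tree.bits (b : ℕ) (t : Tree X) : ℕ := setsBits b t.sets + t.children.bits b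

/-- `f(x | S) = f(S + x) - f(S)`, with two value queries. -/
def marginal (x : X) (S : Finset X) : OProg X ι ℤ := do
  let a ← OProg.value (insert x S)
  let b ← OProg.hold a.size (OProg.value S)
  pure ((a : ℤ) - b)

/-- The first `r` in the list with `f(e | p) ≠ f(e | {r, p})`; `none` for `p` is the dummy
element. -/
def firstClash (A : Setup X ι) (e : X) (p : Option X) : List X → OProg X ι (Option X)
  | [] => pure none
  | r :: rs => do
    let a ← OProg.hold A.elemBits (marginal e p.toFinset)
    let b ← OProg.hold (A.elemBits + 1 + a.natAbs.size) (marginal e (insert r p.toFinset))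
    if a ≠ b then pure (some r) else firstClash A e p rs

/-- Whether `f(r | r') = f(r | e) = f(r | {r', e})` for all `r'` in the list. -/
def sameTrace (A : Setup X ι) (e r : X) : List X → OProg X ι Bool
  | [] => pure true
  | r' :: rs => do
    let a ← OProg.hold (2 * A.elemBits) (marginal r {r'})
    let b ← OProg.hold (2 * A.elemBits + 1 + a.natAbs.size) (marginal r {e})
    let c ← OProg.hold (2 * A.elemBits + 2 + a.natAbs.size + b.natAbs.size) (marginal r {r', e})
    if a = b ∧ b = c then sameTrace A e r rs else pure false

/-- `ProcessElem(e, n)` on the sets `R_1, …, R_z` of `n`; returns the updated sets. -/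
def processElem (A : Setup X ι) (e : X) : List (List X) → OProg X ι (List (List X))
  | [] => pure []
  | R :: Rs => do
    let R' ← OProg.hold ((R.length + 1) * A.elemBits + A.z.size) (repSet A (R ++ [e]))
    let Rnew ← OProg.hold ((R.length + 1 + R'.card) * A.elemBits + A.z.size)
      (pure ((R ++ [e]).filter (· ∈ R')))
    if e ∈ R' then pure (Rnew :: Rs)
    else do
      let Rs' ← processElem A e Rs
      pure (Rnew :: Rs')

/-- `FindNode(e, n)` at a node `n` with parent element `p`, followed by `ProcessElem(e, n)` if the
search ends in `n`; otherwise the search goes on, by `descend r`, among the children of `n` that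
are associated with `r`. Returns the new sets and children of `n`. -/
def visit (A : Setup X ι) (e : X) (p : Option X) (sets : List (List X)) (ch : Forest X)
    (descend : X → OProg X ι (Forest X)) : OProg X ι (List (List X) × Forest X) := do
  match ← firstClash A e p sets.flatten with
  | none => do
    let sets' ← processElem A e sets
    pure (sets', ch)
  | some r => do
    let ch' ← OProg.hold (A.elemBits + 1) (descend r)
    pure (sets, ch')

/-- The part of `FindNode` that goes through the children associated with `r`, and opens a new
child if none of them fits. One bit is kept for every pointer that is followed. -/
def place (A : Setup X ι) (e : X) (r : X) : Forest X → OProg X ι (Forest X)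
  | .nil => do
    let sets ← processElem A e (List.replicate A.z [])
    pure (.cons r sets .nil .nil)
  | .cons p sets ch sib => do
    let fits ← if p = r then sameTrace A e r sets.flatten else pure false
    if fits then do
      let s ← visit A e (some p) sets ch (fun r' => place A e r' ch)
      pure (.cons p s.1 s.2 sib)
    else do
      let sib' ← OProg.hold 1 (place A e r sib)
      pure (.cons p sets ch sib')

/-- `FindNode(e, n)` followed by `ProcessElem`, for the root `n` of a tree. -/
def insertElem (A : Setup X ι) (e : X) (t : Tree X) : OProg X ι (Tree X) := do
  let s ← visit A e none t.sets t.children (fun r => place A e r t.children)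
  pure ⟨s.1, s.2⟩

/-- A tree that consists of its root only, with `R_1 = … = R_z = ∅`. -/
def emptyTree (z : ℕ) : Tree X := ⟨List.replicate z [], .nil⟩

/-- Bits of the trees with the numbers `1, …, z - 1`. -/
def treesBits (A : Setup X ι) (F : ℕ → Tree X) : ℕ :=
  ∑ j ∈ Finset.Icc 1 (A.z - 1), (F j).bits A.elemBits

/-- The main loop; `F j`, for `1 ≤ j ≤ z - 1`, is the tree of the elements `e` with `f(e) = j`.
Elements with `f(e) = 0` belong to no tree and are not stored. -/
def streamFrom (A : Setup X ι) : List X → (ℕ → Tree X) → OProg X ι (Finset X)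
  | [], F =>
    OProg.hold (treesBits A F) (pure ((Finset.Icc 1 (A.z - 1)).biUnion fun j => (F j).elems))
  | e :: es, F => do
    let v ← OProg.hold (treesBits A F + A.elemBits) (OProg.value {e})
    if A.z ≤ v then pure {e}
    else if v = 0 then streamFrom A es F
    else do
      let t ← OProg.hold (treesBits A F + A.elemBits + v.size) (insertElem A e (F v))
      streamFrom A es (Function.update F v t)

def streamingCoverage (A : Setup X ι) (stream : List X) : OProg X ι (Finset X) :=
  streamFrom A stream (fun _ => emptyTree A.z)

/-- `2^{(z-1)^2} z^{2z+1}` for `ℓ = 1` and `2^{(z-1)^2} ℓ^{z(z-1)ℓ} z^{z+1}` for `ℓ > 1`. -/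
def kernelBound (ℓ z : ℕ) : ℕ :=
  if ℓ = 1 then 2 ^ ((z - 1) ^ 2) * z ^ (2 * z + 1)
  else 2 ^ ((z - 1) ^ 2) * ℓ ^ (z * (z - 1) * ℓ) * z ^ (z + 1)

/-- The setup in which an element is written in `⌈log₂ |X|⌉` bits and an index of a matroid in
`⌈log₂ |ι|⌉` bits. -/
def stdSetup [Fintype X] [Fintype ι] (ℓ z : ℕ) (grounds : X → List ι) : Setup X ι where
  z := z
  ℓ := ℓ
  grounds := grounds
  elemBits := Nat.clog 2 (Fintype.card X)
  indexBits := Nat.clog 2 (Fintype.card ι)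

/-- The independence oracles of the matroids `M i`. -/
noncomputable def indepOracle (M : ι → Matroid X) : ι → Finset X → Bool :=
  fun i S => by classical exact decide ((M i).Indep ↑S)

end Coverage

/-! **Representative sets.** Let `b` belong to a feasible set `B`. If the first element `e` of the
input cannot replace `b`, then some matroid spans `e` by the elements of `B` other than `b`. The
branch of `guess` for this matroid adds `e` to `J_i`, which therefore stays independent inside the
span of `B - b`, and discards only elements of that span, hence not `b`. Since `B - b` has at most
`z - 1` elements, each in at most `ℓ` ground sets, the recursion cannot exhaust its
`(z - 1) * ℓ` levels.

**Kernel.** The elements at a node all cover the same number of points, meet the set covered by the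
parent element in the same trace, and are disjoint outside of it. If `e` is rejected by all `z` sets
of a node and belongs to a feasible set `B` of at least `z` points that needs it, then each of the
sets provides an exchange for `e`. As `B - e` covers less than `z` points, one of these `z` elements
meets `B - e` only inside the parent's points, where it covers the same points as `e` does. So it
can replace `e` without loss of coverage.

**Size.** Along a path of a tree the traces increase strictly, and siblings have different pairs of
a parent element and a trace. So a tree whose elements cover `j` points has depth at most `j`, and
a node with `K` elements, each of which covers `m` points outside the common trace, has at most
`K * 2 ^ m` children. -/

/-! ### Specifications of oracle programs -/

namespace OProg

variable {X ι α β γ : Type} {f : Finset X → ℕ} {I : ι → Finset X → Bool}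

/-- A specification of the program `p`, run with the oracles `f` and `I`: its result satisfies
`post`, it makes at most `q` value queries, and it never has more than `b` bits in memory. The rules
below derive a specification of a program from specifications of its parts. -/
structure Meets (f : Finset X → ℕ) (I : ι → Finset X → Bool) (p : OProg X ι β)
    (post : β → Prop) (q b : ℕ) : Prop where
  eval : post (p.eval f I)
  valueQueries_le : p.valueQueries f I ≤ q
  peakBits_le : p.peakBits f I ≤ b

namespace Meets

variable {post : β → Prop} {q b : ℕ}

theorem pure {x : β} (h : post x) : Meets f I (Pure.pure x) post q b :=
  ⟨h, Nat.zero_le q, Nat.zero_le b⟩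

theorem value {post : ℕ → Prop} {S : Finset X} (h : post (f S)) (hq : 1 ≤ q) :
    Meets f I (.value S) post q b :=
  ⟨h, hq, Nat.zero_le b⟩

theorem indep {post : Bool → Prop} {i : ι} {S : Finset X} (h : post (I i S)) :
    Meets f I (.indep i S) post q b :=
  ⟨h, Nat.zero_le q, Nat.zero_le b⟩

theorem hold {p : OProg X ι β} {m b' : ℕ} (hp : Meets f I p post q b') (hb : m + b' ≤ b) :
    Meets f I (.hold m p) post q b :=
  ⟨hp.eval, hp.valueQueries_le, (Nat.add_le_add_left hp.peakBits_le m).trans hb⟩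

theorem bind {p : OProg X ι γ} {k : γ → OProg X ι β} {mid : γ → Prop} {q₁ q₂ : ℕ}
    (hp : Meets f I p mid q₁ b) (hk : ∀ x, mid x → Meets f I (k x) post q₂ b)
    (hq : q₁ + q₂ ≤ q) : Meets f I (p >>= k) post q b :=
  have h := hk _ hp.eval
  ⟨h.eval, (Nat.add_le_add hp.valueQueries_le h.valueQueries_le).trans hq,
    max_le hp.peakBits_le h.peakBits_le⟩

theorem bind₀ {p : OProg X ι γ} {k : γ → OProg X ι β} {mid : γ → Prop}
    (hp : Meets f I p mid 0 b) (hk : ∀ x, mid x → Meets f I (k x) post q b) :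
    Meets f I (p >>= k) post q b :=
  bind hp hk (Nat.zero_add q).le

theorem mono {p : OProg X ι β} {post' : β → Prop} {q' b' : ℕ} (hp : Meets f I p post q b)
    (hpost : ∀ x, post x → post' x) (hq : q ≤ q') (hb : b ≤ b') : Meets f I p post' q' b' :=
  ⟨hpost _ hp.eval, hp.valueQueries_le.trans hq, hp.peakBits_le.trans hb⟩

theorem foldlM {g : β → α → OProg X ι β} {inv : List α → β → Prop}
    (step : ∀ a l x, inv (a :: l) x → Meets f I (g x a) (inv l) q b) (l : List α) {x : β}
    (h : inv l x) : Meets f I (l.foldlM g x) (inv []) (l.length * q) b := by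
  induction l generalizing x with
  | nil => exact pure h
  | cons a l ih =>
    rw [List.foldlM_cons]
    exact bind (step a l x h) (fun y hy => ih hy) (by rw [List.length_cons]; lia)

end Meets

end OProg

namespace Coverage

open OProg (Meets)

section GuessBounds

variable {X ι : Type}

/-- The number of elements that `guess` can select on `d` levels of recursion. -/
def guessBound (ℓ d : ℕ) : ℕ := ∑ i ∈ Finset.range (d + 1), ℓ ^ i

theorem guessBound_succ (ℓ d : ℕ) : guessBound ℓ (d + 1) = 1 + ℓ * guessBound ℓ d := by
  simp only [guessBound, Finset.mul_sum, ← pow_succ']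
  rw [Finset.sum_range_succ', pow_zero, add_comm]

theorem guessBound_mono (ℓ : ℕ) : Monotone (guessBound ℓ) := fun _ _ h =>
  Finset.sum_le_sum_of_subset (Finset.range_mono (Nat.succ_le_succ h))

theorem one_le_guessBound (ℓ d : ℕ) : 1 ≤ guessBound ℓ d := by
  simpa [guessBound] using guessBound_mono ℓ d.zero_le

/-- The memory that one level of recursion of `guess` needs, for input lists of length at most `L`
and `D` levels of recursion in total. -/
def guessBits (A : Setup X ι) (D L : ℕ) : ℕ :=
  (2 * guessBound A.ℓ D + L + D + 1) * A.elemBits + A.indexBits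

/-- The maximal number of elements that `repSet A` selects. -/
def setBound (A : Setup X ι) : ℕ := guessBound A.ℓ ((A.z - 1) * A.ℓ)

/-- The memory that `repSet A` needs for an input list of length at most `L`. -/
def repBits (A : Setup X ι) (L : ℕ) : ℕ :=
  (A.z - 1) * A.ℓ * guessBits A ((A.z - 1) * A.ℓ) L + A.elemBits

theorem add_le_succ_mul_guessBits (A : Setup X ι) {m d D L : ℕ}
    (hm : m ≤ 2 * guessBound A.ℓ D + L + D + 1) :
    m * A.elemBits + A.indexBits + (d * guessBits A D L + A.elemBits) ≤
      (d + 1) * guessBits A D L + A.elemBits := by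
  have level : m * A.elemBits + A.indexBits ≤ guessBits A D L :=
    Nat.add_le_add_right (Nat.mul_le_mul_right _ hm) _
  lia

end GuessBounds

section Guess

variable {X ι : Type} [DecidableEq X] [DecidableEq ι]

/-- Whether `notSpanned A i T` retains the element `y`, for the independence oracles `I`. -/
def kept (A : Setup X ι) (I : ι → Finset X → Bool) (i : ι) (T : Finset X) (y : X) : Bool :=
  if i ∈ A.grounds y then if y ∈ T then false else I i (insert y T) else true

/-- The output of `guess A` for the independence oracles `I`. -/
def guessSet (A : Setup X ι) (I : ι → Finset X → Bool) : ℕ → List (ι × X) → List X → Finset X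
  | _, _, [] => ∅
  | 0, _, e :: _ => {e}
  | d + 1, J, e :: Y => insert e ((A.grounds e).toFinset.biUnion fun i =>
      guessSet A I d ((i, e) :: J) ((e :: Y).filter (kept A I i (insert e (component J i)))))

/-- The output of `repSet A` for the independence oracles `I`. -/
def repFinset (A : Setup X ι) (I : ι → Finset X → Bool) (T : List X) : Finset X :=
  guessSet A I ((A.z - 1) * A.ℓ) [] T

variable (A : Setup X ι) (f : Finset X → ℕ) (I : ι → Finset X → Bool)

theorem card_guessSet_le (hA : ∀ e, (A.grounds e).length ≤ A.ℓ) (d : ℕ) (J : List (ι × X))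
    (Y : List X) : (guessSet A I d J Y).card ≤ guessBound A.ℓ d := by
  induction d generalizing J Y with
  | zero => cases Y <;> simp [guessSet, guessBound]
  | succ d ih =>
    cases Y with
    | nil => simp [guessSet]
    | cons e Y =>
      rw [guessSet, guessBound_succ, add_comm]
      refine (Finset.card_insert_le _ _).trans (Nat.succ_le_succ ?_)
      refine (Finset.card_biUnion_le_card_mul _ _ _ fun i _ => ih _ _).trans ?_
      exact Nat.mul_le_mul_right _ ((List.toFinset_card_le _).trans (hA e))

theorem guessSet_subset (d : ℕ) (J : List (ι × X)) (Y : List X) :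
    guessSet A I d J Y ⊆ Y.toFinset := by
  induction d generalizing J Y with
  | zero => cases Y <;> simp [guessSet]
  | succ d ih =>
    cases Y with
    | nil => simp [guessSet]
    | cons e Y =>
      rw [guessSet, Finset.insert_subset_iff, Finset.biUnion_subset]
      refine ⟨by simp, fun i _ => (ih _ _).trans fun x hx => ?_⟩
      rw [List.mem_toFinset] at hx ⊢
      exact List.mem_of_mem_filter hx

theorem guessSet_subset_append (d : ℕ) (J : List (ι × X)) (Y Z : List X) :
    guessSet A I d J Y ⊆ guessSet A I d J (Y ++ Z) := by
  induction d generalizing J Y Z with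
  | zero => cases Y <;> simp [guessSet]
  | succ d ih =>
    cases Y with
    | nil => simp [guessSet]
    | cons e Y =>
      rw [List.cons_append, guessSet, guessSet]
      refine Finset.insert_subset_insert _ (Finset.biUnion_mono fun i _ => ?_)
      rw [← List.cons_append, List.filter_append]
      exact ih _ _ _

theorem meets_notSpanned (i : ι) (T : Finset X) (Y : List X) (b : ℕ) :
    Meets f I (notSpanned A i T Y) (· = Y.filter (kept A I i T)) 0 b := by
  induction Y with
  | nil => exact .pure rfl
  | cons y Y ih =>
    have tail (keep : Bool) (hkeep : kept A I i T y = keep) :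
        Meets f I (notSpanned A i T Y >>= fun Y' => pure (if keep then y :: Y' else Y'))
          (· = (y :: Y).filter (kept A I i T)) 0 b :=
      ih.bind₀ fun Y' hY' => .pure (by rw [hY', List.filter_cons, hkeep])
    rw [notSpanned]
    split_ifs with hi hy
    · exact Meets.bind₀ (.pure (by simp [kept, hi, hy])) tail
    · exact Meets.bind₀ (.indep (by simp [kept, hi, hy])) tail
    · exact Meets.bind₀ (.pure (by simp [kept, hi])) tail

theorem meets_guess (hA : ∀ e, (A.grounds e).length ≤ A.ℓ) {D L : ℕ} (d : ℕ)
    (J : List (ι × X)) (Y : List X) (hd : J.length + d ≤ D) (hY : Y.length ≤ L) :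
    Meets f I (guess A d J Y) (· = guessSet A I d J Y) 0 (d * guessBits A D L + A.elemBits) := by
  induction d generalizing J Y with
  | zero =>
    cases Y with
    | nil => exact .pure rfl
    | cons e Y => exact .hold (b' := 0) (.pure rfl) (by lia)
  | succ d ih =>
    cases Y with
    | nil => exact .pure rfl
    | cons e Y =>
      let Yi (i : ι) : List X := (e :: Y).filter (kept A I i (insert e (component J i)))
      set Out := guessSet A I (d + 1) J (e :: Y) with hOut
      have hcard {d'} (hd' : d' ≤ D) (J' Y') : (guessSet A I d' J' Y').card ≤ guessBound A.ℓ D :=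
        (card_guessSet_le A I hA d' J' Y').trans (guessBound_mono A.ℓ hd')
      have hmem {m} := add_le_succ_mul_guessBits A (m := m) (d := d) (D := D) (L := L)
      have hYi (i : ι) : (Yi i).length ≤ L := (List.length_filter_le _ _).trans hY
      rw [List.length_cons] at hY
      refine (Meets.foldlM (q := 0) (inv := fun l R =>
        R ∪ l.toFinset.biUnion (fun i => guessSet A I d ((i, e) :: J) (Yi i)) = Out)
        (fun i l R hR => ?_) (A.grounds e) ?_).mono (fun R hR => by simpa using hR) le_rfl le_rfl
      · have hRcard : R.card ≤ guessBound A.ℓ D :=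
          (Finset.card_le_card (hR ▸ Finset.subset_union_left)).trans (hcard (by lia) _ _)
        have hR'card := hcard (d' := d) (by lia) ((i, e) :: J) (Yi i)
        refine .bind₀ (.hold (meets_notSpanned A f I i _ (e :: Y) 0) ?_) ?_
        · exact (Nat.add_le_add_left (Nat.zero_le _) _).trans (hmem (by lia))
        rintro _ rfl
        refine .bind₀ (.hold (ih _ (Yi i) (by rw [List.length_cons]; lia) (hYi i)) ?_) ?_
        · exact hmem (by linarith [hYi i])
        rintro _ rfl
        refine .hold (b' := 0) (.pure ?_) ?_
        · rw [← hR, List.toFinset_cons, Finset.biUnion_insert, Finset.union_assoc]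
        · refine le_trans ?_ (hmem ((Nat.add_le_add hRcard hR'card).trans (by lia)))
          lia
      · rw [hOut, guessSet, Finset.singleton_union]

theorem meets_repSet (hA : ∀ e, (A.grounds e).length ≤ A.ℓ) {T : List X} {L : ℕ}
    (hT : T.length ≤ L) : Meets f I (repSet A T) (· = repFinset A I T) 0 (repBits A L) :=
  meets_guess A f I hA _ _ _ (by simp) hT

theorem repFinset_subset (T : List X) : repFinset A I T ⊆ T.toFinset :=
  guessSet_subset A I _ _ T

theorem repFinset_subset_append (T T' : List X) :
    repFinset A I T ⊆ repFinset A I (T ++ T') :=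
  guessSet_subset_append A I _ _ T T'

theorem card_repFinset_le (hA : ∀ e, (A.grounds e).length ≤ A.ℓ) (T : List X) :
    (repFinset A I T).card ≤ setBound A :=
  card_guessSet_le A I hA _ _ T

end Guess

end Coverage

/-! ### Representative sets -/

section Feasible

variable {X ι : Type} {M : ι → Matroid X} {B : Finset X} {e : X} {i : ι}

theorem Feasible.mono {B' : Finset X} (hB : Feasible M B) (h : B' ⊆ B) : Feasible M B' := fun i =>
  (hB i).subset (Set.inter_subset_inter_left _ (Finset.coe_subset.2 h))

theorem Feasible.notMem_closure_erase [DecidableEq X] (hB : Feasible M B) (he : e ∈ B)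
    (heE : e ∈ (M i).E) : e ∉ (M i).closure (↑(B.erase e) ∩ (M i).E) := by
  rw [(hB.mono (B.erase_subset e) i).notMem_closure_iff heE, ← Set.insert_inter_of_mem heE,
    ← Finset.coe_insert, Finset.insert_erase he]
  exact ⟨hB i, by simp⟩

theorem Feasible.exists_mem_closure [DecidableEq X] (hB : Feasible M B)
    (h : ¬ Feasible M (insert e B)) : ∃ i, e ∈ (M i).E ∧ e ∈ (M i).closure (↑B ∩ (M i).E) := by
  obtain ⟨i, hi⟩ := not_forall.1 h
  rw [Finset.coe_insert] at hi
  by_cases heE : e ∈ (M i).E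
  · refine ⟨i, heE, not_not.1 fun hcl => hi ?_⟩
    rw [Set.insert_inter_of_mem heE]
    exact (((hB i).notMem_closure_iff heE).1 hcl).1
  · exact absurd (hB i) (by rwa [Set.insert_inter_of_notMem heE] at hi)

end Feasible

namespace Coverage

open OProg (Meets)

section Presents

variable {X ι : Type}

/-- The setup `A` describes the `A.ℓ`-matchoid `M`, in which all singletons are feasible. -/
structure Presents (A : Setup X ι) (M : ι → Matroid X) : Prop where
  isMatchoid : IsMatchoid A.ℓ M
  mem_grounds : ∀ e i, i ∈ A.grounds e ↔ e ∈ (M i).E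
  nodup_grounds : ∀ e, (A.grounds e).Nodup
  feasible_singleton : ∀ e, Feasible M {e}

theorem Presents.length_grounds_le {A : Setup X ι} {M : ι → Matroid X} (h : Presents A M)
    (e : X) : (A.grounds e).length ≤ A.ℓ := by
  classical
  have hcard := h.isMatchoid e
  have hset : {i | e ∈ (M i).E} = ↑(A.grounds e).toFinset := by
    ext i
    simp [h.mem_grounds e i]
  rw [hset, Set.encard_coe_eq_coe_finsetCard,
    List.toFinset_card_of_nodup (h.nodup_grounds e)] at hcard
  exact_mod_cast hcard

end Presents

section Component

variable {X ι : Type} [DecidableEq X] [DecidableEq ι]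

theorem mem_component {J : List (ι × X)} {i : ι} {x : X} : x ∈ component J i ↔ (i, x) ∈ J := by
  simp [component]

theorem component_cons (i : ι) (e : X) (J : List (ι × X)) (i' : ι) :
    component ((i, e) :: J) i' =
      if i = i' then insert e (component J i') else component J i' := by
  by_cases h : i = i' <;> simp [component, h]

theorem component_cons_self (i : ι) (e : X) (J : List (ι × X)) :
    component ((i, e) :: J) i = insert e (component J i) := by
  rw [component_cons, if_pos rfl]

theorem sum_card_component (J : List (ι × X)) :
    ∑ i ∈ (J.map Prod.fst).toFinset, (component J i).card = J.toFinset.card := by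
  rw [Finset.card_eq_sum_card_fiberwise (f := Prod.fst) (t := (J.map Prod.fst).toFinset)
    (fun q hq => by simpa using ⟨q.2, by simpa using hq⟩)]
  refine Finset.sum_congr rfl fun i _ => ?_
  have himage : component J i = (J.toFinset.filter (·.1 = i)).image Prod.snd := by
    ext x
    simp [mem_component]
  rw [himage]
  refine Finset.card_image_of_injOn fun p hp q hq hpq => Prod.ext ?_ hpq
  simp only [Finset.coe_filter, Set.mem_ofPred_eq] at hp hq
  rw [hp.2, hq.2]

end Component

section Representative

variable {X ι : Type} [DecidableEq X] [DecidableEq ι]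

/-- The multi-dimensional set `J`, which lists no pair twice, has independent components that are
spanned by `D`. -/
structure SpannedBy (M : ι → Matroid X) (D : Finset X) (J : List (ι × X)) : Prop where
  indep : ∀ i, (M i).Indep ↑(component J i)
  subset_closure : ∀ i, ↑(component J i) ⊆ (M i).closure (↑D ∩ (M i).E)
  nodup : J.Nodup

/-- No component of the multi-dimensional set `J` spans `y`. -/
def Unspanned (M : ι → Matroid X) (J : List (ι × X)) (y : X) : Prop :=
  ∀ i, y ∈ (M i).E → y ∉ (M i).closure ↑(component J i)

variable {A : Setup X ι} {M : ι → Matroid X} {B D : Finset X} {J : List (ι × X)} {i : ι} {b e : X}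

theorem SpannedBy.nil (M : ι → Matroid X) (D : Finset X) : SpannedBy M D [] where
  indep i := by simp [component]
  subset_closure i := by simp [component]
  nodup := List.nodup_nil

theorem SpannedBy.cons (hJ : SpannedBy M D J) (he : e ∈ (M i).E) (heJ : Unspanned M J e)
    (heD : e ∈ (M i).closure (↑D ∩ (M i).E)) : SpannedBy M D ((i, e) :: J) := by
  obtain ⟨hindep, hnotMem⟩ := ((hJ.indep i).notMem_closure_iff he).1 (heJ i he)
  refine ⟨fun i' => ?_, fun i' => ?_, List.nodup_cons.2 ⟨mt mem_component.2 hnotMem, hJ.nodup⟩⟩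
  · obtain rfl | hi := eq_or_ne i i'
    · rwa [component_cons_self, Finset.coe_insert]
    · rw [component_cons, if_neg hi]
      exact hJ.indep i'
  · obtain rfl | hi := eq_or_ne i i'
    · rw [component_cons_self, Finset.coe_insert]
      exact Set.insert_subset heD (hJ.subset_closure i)
    · rw [component_cons, if_neg hi]
      exact hJ.subset_closure i'

theorem SpannedBy.card_component_le [DecidablePred (· ∈ (M i).E)] (hJ : SpannedBy M D J) :
    (component J i).card ≤ (D.filter (· ∈ (M i).E)).card := by
  have hrank := (hJ.indep i).encard_le_eRk_of_subset (hJ.subset_closure i)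
  rw [Matroid.eRk_closure_eq] at hrank
  have hle := hrank.trans ((M i).eRk_le_encard _)
  have hinter : (↑D ∩ (M i).E : Set X) = ↑(D.filter (· ∈ (M i).E)) := by
    ext x
    simp
  rw [hinter, Set.encard_coe_eq_coe_finsetCard, Set.encard_coe_eq_coe_finsetCard] at hle
  exact_mod_cast hle

theorem SpannedBy.length_le {ℓ : ℕ} (hM : IsMatchoid ℓ M) (hJ : SpannedBy M D J) :
    J.length ≤ D.card * ℓ := by
  classical
  set S := (J.map Prod.fst).toFinset
  calc J.length = ∑ i ∈ S, (component J i).card := by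
        rw [sum_card_component, List.toFinset_card_of_nodup hJ.nodup]
    _ ≤ ∑ i ∈ S, (D.filter (· ∈ (M i).E)).card := Finset.sum_le_sum fun i _ => hJ.card_component_le
    _ = ∑ x ∈ D, (S.filter (fun i => x ∈ (M i).E)).card :=
        Finset.sum_card_bipartiteAbove_eq_sum_card_bipartiteBelow fun i x => x ∈ (M i).E
    _ ≤ D.card * ℓ := Finset.sum_le_card_nsmul _ _ _ fun x _ => ?_
  rw [← ENat.natCast_le_natCast, ← Set.encard_coe_eq_coe_finsetCard]
  exact (Set.encard_le_encard fun i hi => (Finset.mem_filter.1 hi).2).trans (hM x)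

theorem unspanned_nil (he : Feasible M {e}) : Unspanned M ([] : List (ι × X)) e := by
  intro i heE
  have := he.notMem_closure_erase (Finset.mem_singleton_self e) heE
  simpa [component] using this

theorem SpannedBy.unspanned (hJ : SpannedBy M (B.erase b) J) (hB : Feasible M B) (hb : b ∈ B) :
    Unspanned M J b := fun i hbE hbJ =>
  hB.notMem_closure_erase hb hbE
    ((M i).closure_subset_closure_of_subset_closure (hJ.subset_closure i) hbJ)

theorem kept_iff (hA : Presents A M) {T : Finset X} (hT : (M i).Indep ↑T) (y : X) :
    kept A (indepOracle M) i T y ↔ (y ∈ (M i).E → y ∉ (M i).closure ↑T) := by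
  rw [kept]
  by_cases hy : y ∈ (M i).E
  · rw [if_pos ((hA.mem_grounds y i).2 hy), hT.notMem_closure_iff hy]
    by_cases hyT : y ∈ T <;> simp [hy, hyT, indepOracle]
  · rw [if_neg (mt (hA.mem_grounds y i).1 hy)]
    simp [hy]

theorem SpannedBy.unspanned_cons_iff (hA : Presents A M) (hJ : SpannedBy M D ((i, e) :: J))
    {y : X} (hy : Unspanned M J y) : Unspanned M ((i, e) :: J) y ↔
      kept A (indepOracle M) i (insert e (component J i)) y := by
  have hindep := hJ.indep i
  rw [component_cons_self] at hindep
  rw [kept_iff hA hindep]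
  refine ⟨fun h => component_cons_self i e J ▸ h i, fun h i' => ?_⟩
  obtain rfl | hi := eq_or_ne i i'
  · rwa [component_cons_self]
  · rw [component_cons, if_neg hi]
    exact hy i'

theorem head_mem_guessSet (A : Setup X ι) (I : ι → Finset X → Bool) (d : ℕ) (J : List (ι × X))
    (e : X) (Y : List X) : e ∈ guessSet A I d J (e :: Y) := by
  cases d <;> simp [guessSet]

theorem exists_mem_guessSet (hA : Presents A M) {w : X → ℝ} (hB : Feasible M B) (hb : b ∈ B)
    (d : ℕ) (J : List (ι × X)) (Y : List X) (hJ : SpannedBy M (B.erase b) J)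
    (hYJ : ∀ y ∈ Y, Unspanned M J y) (hbY : b ∈ Y) (hw : Y.Pairwise fun a c => w c ≤ w a)
    (hd : (B.erase b).card * A.ℓ ≤ J.length + d) :
    ∃ e ∈ guessSet A (indepOracle M) d J Y, w b ≤ w e ∧ Feasible M (insert e (B.erase b)) := by
  obtain ⟨e, Y, rfl⟩ := List.exists_cons_of_ne_nil (List.ne_nil_of_mem hbY)
  by_cases hf : Feasible M (insert e (B.erase b))
  · refine ⟨e, head_mem_guessSet _ _ _ _ _ _, ?_, hf⟩
    rcases List.mem_cons.1 hbY with rfl | hbY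
    exacts [le_rfl, (List.pairwise_cons.1 hw).1 b hbY]
  -- As `e` fits into no feasible set with `B - b`, some matroid lets `J` grow by `e`; a set spanned
  -- by `B - b` can grow only `|B - b| ℓ` times, so levels of recursion are left.
  obtain ⟨i, he, hecl⟩ := (hB.mono (B.erase_subset b)).exists_mem_closure hf
  have hJe : SpannedBy M (B.erase b) ((i, e) :: J) := hJ.cons he (hYJ e List.mem_cons_self) hecl
  have hlen : J.length + 1 ≤ (B.erase b).card * A.ℓ := hJe.length_le hA.isMatchoid
  cases d with
  | zero => lia
  | succ d =>
    obtain ⟨x, hx, hwx, hxf⟩ := exists_mem_guessSet hA hB hb d ((i, e) :: J)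
      ((e :: Y).filter (kept A (indepOracle M) i (insert e (component J i)))) hJe
      (fun y hy => by
        rw [List.mem_filter] at hy
        exact (hJe.unspanned_cons_iff hA (hYJ y hy.1)).2 hy.2)
      (List.mem_filter.2
        ⟨hbY, (hJe.unspanned_cons_iff hA (hYJ b hbY)).1 (hJe.unspanned hB hb)⟩)
      (hw.filter _) (by rw [List.length_cons]; lia)
    refine ⟨x, ?_, hwx, hxf⟩
    rw [guessSet]
    exact Finset.mem_insert_of_mem
      (Finset.mem_biUnion.2 ⟨i, List.mem_toFinset.2 ((hA.mem_grounds e i).2 he), hx⟩)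

theorem isJointRepSet_repFinset (hA : Presents A M) {w : X → ℝ} {T : List X}
    (hw : T.Pairwise fun a c => w c ≤ w a) :
    IsJointRepSet M A.z T.toFinset w (repFinset A (indepOracle M) T) := by
  refine ⟨repFinset_subset A _ T, fun B hB hcard b hb => ?_⟩
  rw [Finset.mem_inter, List.mem_toFinset] at hb
  refine exists_mem_guessSet hA hB hb.2 _ _ _ (SpannedBy.nil M _)
    (fun y _ => unspanned_nil (hA.feasible_singleton y)) hb.1 hw ?_
  rw [Finset.card_erase_of_mem hb.2, List.length_nil, zero_add]
  exact Nat.mul_le_mul_right _ (Nat.sub_le_sub_right hcard 1)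

end Representative

/-! ### The sets at a node -/

section Coverage

variable {X U : Type} [DecidableEq U]

/-- The unweighted coverage function in which the element `e` covers the points of `P e`. -/
def coverage (P : X → Finset U) (S : Finset X) : ℕ := (S.biUnion P).card

variable (P : X → Finset U)

theorem coverage_singleton (e : X) : coverage P {e} = (P e).card := by
  rw [coverage, Finset.singleton_biUnion]

theorem coverage_insert [DecidableEq X] (e : X) (S : Finset X) :
    coverage P (insert e S) = (P e ∪ S.biUnion P).card := by
  rw [coverage, Finset.biUnion_insert]

theorem exists_subset_card_le_of_le_coverage {S : Finset X} {z : ℕ}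
    (h : z ≤ coverage P S) : ∃ T ⊆ S, T.card ≤ z ∧ z ≤ coverage P T := by
  classical
  obtain ⟨W, hW, rfl⟩ := Finset.exists_subset_card_eq h
  choose g hgS hgP using fun x : W => Finset.mem_biUnion.1 (hW x.2)
  refine ⟨Finset.univ.image g, Finset.image_subset_iff.2 fun x _ => hgS x, ?_, ?_⟩
  · simpa using Finset.card_image_le (s := Finset.univ) (f := g)
  · exact Finset.card_le_card fun x hx => Finset.mem_biUnion.2
      ⟨g ⟨x, hx⟩, Finset.mem_image_of_mem g (Finset.mem_univ _), hgP ⟨x, hx⟩⟩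

end Coverage

section Sunflower

variable {α U : Type}

theorem exists_disjoint_of_card_lt {T : Finset α} {g : α → Finset U} {W : Finset U}
    (hg : (T : Set α).PairwiseDisjoint g) (hW : W.card < T.card) :
    ∃ x ∈ T, Disjoint (g x) W := by
  classical
  by_contra! hmeet
  have hcard : T.card ≤ (T.biUnion fun x => g x ∩ W).card :=
    Finset.card_le_card_biUnion (hg.mono fun x => Finset.inter_subset_left) fun x hx =>
      Finset.not_disjoint_iff_nonempty_inter.1 (hmeet x hx)
  have hsub : (T.biUnion fun x => g x ∩ W) ⊆ W :=
    Finset.biUnion_subset.2 fun x _ => Finset.inter_subset_right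
  exact hW.not_ge (hcard.trans (Finset.card_le_card hsub))

theorem card_union_le_card_union_of_disjoint [DecidableEq U] {C W s t : Finset U}
    (hcard : s.card = t.card) (hC : s ∩ C = t ∩ C) (hd : Disjoint (t \ C) W) :
    (s ∪ W).card ≤ (t ∪ W).card := by
  have hsplit (u : Finset U) : u ∪ W = (u ∩ C ∪ W) ∪ u \ C := by
    rw [Finset.union_right_comm, Finset.union_comm (u ∩ C), Finset.sdiff_union_inter]
  have hsdiff : (s \ C).card = (t \ C).card := by
    rw [Finset.card_sdiff, Finset.card_sdiff, Finset.inter_comm C, Finset.inter_comm C, hC, hcard]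
  have hdisj : Disjoint (t ∩ C ∪ W) (t \ C) :=
    Finset.disjoint_union_left.2 ⟨(Finset.disjoint_sdiff_inter t C).symm, hd.symm⟩
  calc (s ∪ W).card ≤ (t ∩ C ∪ W).card + (s \ C).card := by
        rw [hsplit s, hC]
        exact Finset.card_union_le _ _
    _ = (t ∪ W).card := by rw [hsplit t, Finset.card_union_of_disjoint hdisj, hsdiff]

theorem length_le_card_filter_flatten [DecidableEq α] {L : List (List α)} (hL : L.flatten.Nodup)
    {p : α → Prop} [DecidablePred p] (hp : ∀ R ∈ L, ∃ x ∈ R, p x) :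
    L.length ≤ (L.flatten.toFinset.filter p).card := by
  have hcount : (L.flatten.toFinset.filter p).card = (L.map (·.countP (p ·))).sum := by
    rw [← List.countP_flatten, List.countP_eq_length_filter,
      ← List.toFinset_card_of_nodup (hL.filter _), List.toFinset_filter]
    simp
  rw [hcount, ← List.length_map (as := L) (·.countP (p ·))]
  refine List.length_le_sum_of_one_le _ fun c hc => ?_
  obtain ⟨R, hR, rfl⟩ := List.mem_map.1 hc
  exact List.countP_pos_iff.2 (by simpa using hp R hR)

theorem length_flatten_le {c : ℕ} {L : List (List α)} (h : ∀ R ∈ L, R.length ≤ c) :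
    L.flatten.length ≤ L.length * c := by
  rw [List.length_flatten, ← List.length_map (as := L) List.length, ← smul_eq_mul]
  exact List.sum_le_card_nsmul _ c (List.forall_mem_map.2 h)

end Sunflower

section Sets

variable {X ι : Type} [DecidableEq X] [DecidableEq ι] {A : Setup X ι} {f : Finset X → ℕ}
  {I : ι → Finset X → Bool} {e : X} {R : List X} {sets : List (List X)}

/-- `repSet A` selects all elements of `R`. -/
def Stable (A : Setup X ι) (I : ι → Finset X → Bool) (R : List X) : Prop :=
  R.toFinset ⊆ repFinset A I R

/-- The output of `processElem A e` on stable sets: `e` is added to the first set in which it is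
selected. -/
def insertSets (A : Setup X ι) (I : ι → Finset X → Bool) (e : X) : List (List X) → List (List X)
  | [] => []
  | R :: Rs => if e ∈ repFinset A I (R ++ [e]) then (R ++ [e]) :: Rs else R :: insertSets A I e Rs

theorem Stable.nil : Stable A I [] := Finset.empty_subset _

theorem Stable.append (h : Stable A I R) (he : e ∈ repFinset A I (R ++ [e])) :
    Stable A I (R ++ [e]) := by
  rw [Stable, List.toFinset_append, List.toFinset_cons, List.toFinset_nil, Finset.union_subset_iff]
  exact ⟨h.trans (repFinset_subset_append A I R [e]), by simpa using he⟩

theorem Stable.filter_append (h : Stable A I R) :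
    (R ++ [e]).filter (· ∈ repFinset A I (R ++ [e])) =
      if e ∈ repFinset A I (R ++ [e]) then R ++ [e] else R := by
  have hR : R.filter (· ∈ repFinset A I (R ++ [e])) = R := List.filter_eq_self.2 fun x hx =>
    decide_eq_true (repFinset_subset_append A I R [e] (h (List.mem_toFinset.2 hx)))
  rw [List.filter_append, hR]
  split_ifs with he <;> simp [he]

theorem Stable.length_le (hA : ∀ e, (A.grounds e).length ≤ A.ℓ) (h : Stable A I R)
    (hR : R.Nodup) : R.length ≤ setBound A := by
  rw [← List.toFinset_card_of_nodup hR]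
  exact (Finset.card_le_card h).trans (card_repFinset_le A I hA R)

theorem length_insertSets (sets : List (List X)) :
    (insertSets A I e sets).length = sets.length := by
  induction sets with
  | nil => rfl
  | cons R Rs ih => rw [insertSets]; split_ifs <;> simp [ih]

theorem stable_insertSets (h : ∀ R ∈ sets, Stable A I R) :
    ∀ R ∈ insertSets A I e sets, Stable A I R := by
  induction sets with
  | nil => exact h
  | cons R Rs ih =>
    rw [List.forall_mem_cons] at h
    rw [insertSets]
    split_ifs with he
    · exact List.forall_mem_cons.2 ⟨h.1.append he, h.2⟩
    · exact List.forall_mem_cons.2 ⟨h.1, ih h.2⟩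

theorem insertSets_cases (sets : List (List X)) :
    (insertSets A I e sets).flatten.Perm (e :: sets.flatten) ∨
      insertSets A I e sets = sets ∧ ∀ R ∈ sets, e ∉ repFinset A I (R ++ [e]) := by
  induction sets with
  | nil => exact .inr ⟨rfl, by simp⟩
  | cons R Rs ih =>
    rw [insertSets]
    split_ifs with he
    · exact .inl (by simp)
    · rcases ih with ih | ⟨ih, h⟩
      · exact .inl ((ih.append_left R).trans List.perm_middle)
      · exact .inr ⟨by rw [ih], List.forall_mem_cons.2 ⟨he, h⟩⟩

theorem flatten_insertSets_replicate {z : ℕ} (hz : 1 ≤ z) :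
    (insertSets A I e (List.replicate z [])).flatten = [e] := by
  obtain ⟨z, rfl⟩ := Nat.exists_eq_add_of_le' hz
  rw [List.replicate_succ, insertSets,
    if_pos (show e ∈ repFinset A I ([] ++ [e]) from head_mem_guessSet A I _ [] e [])]
  simp

end Sets

section NodeUpdate

variable {X ι : Type}

/-- The memory that `firstClash A` and `sameTrace A` need for elements that cover less than `A.z`
points. -/
def compareBits (A : Setup X ι) : ℕ := 2 * A.elemBits + 2 + 5 * A.z

/-- The memory that the work at a single node needs. -/
def workBits (A : Setup X ι) : ℕ :=
  compareBits A + ((2 * setBound A + 1) * A.elemBits + A.z + repBits A (setBound A + 1))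

theorem size_le_self (n : ℕ) : n.size ≤ n := Nat.size_le.2 n.lt_two_pow_self

variable [DecidableEq X] [DecidableEq ι] {A : Setup X ι} {I : ι → Finset X → Bool}
  {sets : List (List X)}

theorem meets_processElem (hA : ∀ e, (A.grounds e).length ≤ A.ℓ) (f : Finset X → ℕ) (e : X)
    (hstable : ∀ R ∈ sets, Stable A I R) (hlen : ∀ R ∈ sets, R.length ≤ setBound A) :
    Meets f I (processElem A e sets) (· = insertSets A I e sets) 0 (workBits A) := by
  induction sets with
  | nil => exact .pure rfl
  | cons R Rs ih =>
    rw [List.forall_mem_cons] at hstable hlen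
    have hsize := size_le_self A.z
    have hmem {m : ℕ} (hm : m ≤ 2 * setBound A + 1) :
        m * A.elemBits + A.z.size + repBits A (setBound A + 1) ≤ workBits A := by
      have := Nat.mul_le_mul_right A.elemBits hm
      rw [workBits]
      lia
    rw [processElem, insertSets]
    refine .bind₀ (.hold (meets_repSet A f I hA (by simpa using hlen.1)) (hmem (by lia))) ?_
    rintro _ rfl
    have hcard := card_repFinset_le A I hA (R ++ [e])
    refine .bind₀ (.hold (b' := repBits A (setBound A + 1)) (Meets.pure
      (post := (· = if e ∈ repFinset A I (R ++ [e]) then R ++ [e] else R))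
      hstable.1.filter_append) (hmem (by lia))) ?_
    rintro _ rfl
    split_ifs
    · exact .pure rfl
    · exact (ih hstable.2 hlen.2).bind₀ fun _ h => .pure (by rw [h])

end NodeUpdate

section Kernel

variable {X ι U : Type} [DecidableEq X] [DecidableEq U] {M : ι → Matroid X} {P : X → Finset U}
  {z : ℕ} {e : X} {R S : Finset X}

/-- In every feasible set of at most `z` elements whose value is at least `z` only because of `e`,
the element `e` can be exchanged for an element of `R`. -/
def Substitutable (M : ι → Matroid X) (P : X → Finset U) (z : ℕ) (e : X) (R : Finset X) : Prop :=
  ∀ B, Feasible M B → B.card ≤ z → e ∈ B → coverage P (B.erase e) < z → z ≤ coverage P B →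
    ∃ e' ∈ R, Feasible M (insert e' (B.erase e)) ∧ z ≤ coverage P (insert e' (B.erase e))

theorem Substitutable.mono {R' : Finset X} (h : Substitutable M P z e R) (hR : R ⊆ R') :
    Substitutable M P z e R' := fun B hB hcard he hlt hle =>
  let ⟨e', he', h'⟩ := h B hB hcard he hlt hle
  ⟨e', hR he', h'⟩

theorem Substitutable.of_mem (h : e ∈ R) : Substitutable M P z e R := fun B hB _ he _ hle =>
  ⟨e, h, by rwa [Finset.insert_erase he], by rwa [Finset.insert_erase he]⟩

theorem Substitutable.of_coverage_eq_zero (h : coverage P {e} = 0) :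
    Substitutable M P z e R := fun B _ _ he hlt hle => by
  rw [coverage_singleton, Finset.card_eq_zero] at h
  rw [← Finset.insert_erase he, coverage_insert, h, Finset.empty_union] at hle
  exact absurd hle hlt.not_ge

theorem Substitutable.exists_card_sdiff_lt (h : Substitutable M P z e R) (heS : e ∈ S)
    (heR : e ∉ R) (hS : Feasible M S) (hcard : S.card ≤ z) (hcov : z ≤ coverage P S) :
    ∃ S', Feasible M S' ∧ S'.card ≤ z ∧ z ≤ coverage P S' ∧ (S' \ R).card < (S \ R).card := by
  have herase : (S.erase e \ R).card < (S \ R).card := by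
    rw [Finset.erase_sdiff_comm]
    exact Finset.card_erase_lt_of_mem (Finset.mem_sdiff.2 ⟨heS, heR⟩)
  by_cases hz : z ≤ coverage P (S.erase e)
  · exact ⟨_, hS.mono (S.erase_subset e), (Finset.card_erase_le).trans hcard, hz, herase⟩
  · obtain ⟨e', he', hf, hc⟩ := h S hS hcard heS (not_le.1 hz) hcov
    refine ⟨_, hf, (Finset.card_insert_le _ _).trans ?_, hc, ?_⟩
    · rwa [Finset.card_erase_add_one heS]
    · rwa [Finset.insert_sdiff_of_mem _ he']

theorem isKernel_of_substitutable (h : ∀ e, Substitutable M P z e R) :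
    IsKernel M (coverage P) z R := by
  rintro ⟨O, hO, hOz⟩
  obtain ⟨S, hSO, hcard, hcov⟩ := exists_subset_card_le_of_le_coverage P hOz
  have hS := hO.mono hSO
  clear hSO
  induction hn : (S \ R).card using Nat.strong_induction_on generalizing S with
  | _ n ih =>
    subst hn
    by_cases hSR : S ⊆ R
    · exact ⟨S, hSR, hS, hcov, hcard⟩
    · obtain ⟨e, heS, heR⟩ := Finset.not_subset.1 hSR
      obtain ⟨S', hS', hcard', hcov', hlt⟩ := (h e).exists_card_sdiff_lt heS heR hS hcard hcov
      exact ih _ hlt S' hcard' hcov' hS' rfl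

end Kernel

section Nodes

variable {X ι U : Type} [DecidableEq X] [DecidableEq ι] [DecidableEq U]

/-- The invariant of the sets at a node whose parent element covers `C`: all elements cover `j`
points, have the trace `Q` on `C`, and are disjoint outside of `C`. -/
structure NodeInv (A : Setup X ι) (I : ι → Finset X → Bool) (P : X → Finset U) (j : ℕ)
    (C Q : Finset U) (sets : List (List X)) : Prop where
  length_eq : sets.length = A.z
  stable : ∀ R ∈ sets, Stable A I R
  nodup : sets.flatten.Nodup
  card_eq : ∀ r ∈ sets.flatten, (P r).card = j
  trace_eq : ∀ r ∈ sets.flatten, P r ∩ C = Q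
  sunflower : {r | r ∈ sets.flatten}.PairwiseDisjoint fun r => P r \ C

/-- The requirements on an element `e` whose search reaches such a node. -/
structure Reaches (P : X → Finset U) (j : ℕ) (C Q : Finset U) (sets : List (List X))
    (e : X) : Prop where
  notMem : e ∉ sets.flatten
  card_eq : (P e).card = j
  trace_eq : P e ∩ C = Q

/-- The set `s'` arises from `s` by the addition of at most the element `e`. -/
structure Grows (e : X) (s s' : Finset X) : Prop where
  subset : s ⊆ s'
  subset_insert : s' ⊆ insert e s

theorem Grows.refl (e : X) (s : Finset X) : Grows e s s := ⟨subset_rfl, s.subset_insert e⟩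

theorem Grows.union {e : X} {s s' t t' : Finset X} (hs : Grows e s s') (ht : Grows e t t') :
    Grows e (s ∪ t) (s' ∪ t') :=
  ⟨Finset.union_subset_union hs.subset ht.subset,
    (Finset.union_subset_union hs.subset_insert ht.subset_insert).trans
      (Finset.insert_union_distrib e s t).ge⟩

variable {A : Setup X ι} {I : ι → Finset X → Bool} {P : X → Finset U} {j : ℕ} {C Q : Finset U}
  {sets : List (List X)} {e : X}

theorem grows_insertSets (A : Setup X ι) (I : ι → Finset X → Bool) (sets : List (List X))
    (e : X) : Grows e sets.flatten.toFinset (insertSets A I e sets).flatten.toFinset := by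
  rcases insertSets_cases (A := A) (I := I) (e := e) sets with h | ⟨h, -⟩
  · rw [List.toFinset_eq_of_perm _ _ h, List.toFinset_cons]
    exact ⟨Finset.subset_insert _ _, subset_rfl⟩
  · rw [h]
    exact .refl e _

theorem nodeInv_replicate (A : Setup X ι) (I : ι → Finset X → Bool) (P : X → Finset U) (j : ℕ)
    (C Q : Finset U) : NodeInv A I P j C Q (List.replicate A.z []) where
  length_eq := List.length_replicate
  stable R hR := by
    rw [List.eq_of_mem_replicate hR]
    exact Stable.nil
  nodup := by simp
  card_eq := by simp
  trace_eq := by simp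
  sunflower := by simp

theorem NodeInv.add (h : NodeInv A I P j C Q sets) (he : Reaches P j C Q sets e)
    (hd : ∀ r ∈ sets.flatten, Disjoint (P e \ C) (P r)) :
    NodeInv A I P j C Q (insertSets A I e sets) := by
  rcases insertSets_cases (A := A) (I := I) (e := e) sets with hperm | ⟨heq, -⟩
  · have hmem (x : X) : x ∈ (insertSets A I e sets).flatten ↔ x = e ∨ x ∈ sets.flatten :=
      hperm.mem_iff.trans List.mem_cons
    exact
      { length_eq := (length_insertSets sets).trans h.length_eq
        stable := stable_insertSets h.stable
        nodup := hperm.nodup_iff.2 (List.nodup_cons.2 ⟨he.notMem, h.nodup⟩)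
        card_eq := by simpa only [hmem, forall_eq_or_imp] using ⟨he.card_eq, h.card_eq⟩
        trace_eq := by simpa only [hmem, forall_eq_or_imp] using ⟨he.trace_eq, h.trace_eq⟩
        sunflower := by
          simp only [hmem]
          exact h.sunflower.insert fun r hr _ => (hd r hr).mono_right Finset.sdiff_subset }
  · rwa [heq]

theorem NodeInv.substitutable {M : ι → Matroid X} (hA : Presents A M)
    (h : NodeInv A (indepOracle M) P j C Q sets) (he : Reaches P j C Q sets e) :
    Substitutable M P A.z e (insertSets A (indepOracle M) e sets).flatten.toFinset := by
  classical
  rcases insertSets_cases (A := A) (I := indepOracle M) (e := e) sets with hperm | ⟨heq, hrep⟩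
  · exact .of_mem (List.mem_toFinset.2 (hperm.mem_iff.2 List.mem_cons_self))
  rw [heq]
  intro B hB hcard heB hlt hle
  let fits (x : X) : Prop := Feasible M (insert x (B.erase e))
  have hfits : ∀ R ∈ sets, ∃ x ∈ R, fits x := fun R hR => by
    obtain ⟨hsub, hex⟩ := isJointRepSet_repFinset hA (w := fun _ => 0)
      (List.pairwise_of_forall (l := R ++ [e]) fun _ _ => le_rfl)
    obtain ⟨x, hx, -, hxf⟩ := hex B hB hcard e (by simpa using heB)
    have hxR := List.mem_append.1 (List.mem_toFinset.1 (hsub hx))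
    refine ⟨x, hxR.resolve_right fun hxe => hrep R hR ?_, hxf⟩
    exact List.mem_singleton.1 hxe ▸ hx
  -- `z` exchangeable elements are disjoint outside of `C`, and `B - e` covers less than `z` points.
  have hpetals : ((B.erase e).biUnion P).card < (sets.flatten.toFinset.filter fits).card :=
    hlt.trans_le (h.length_eq ▸ length_le_card_filter_flatten h.nodup hfits)
  obtain ⟨x, hx, hdisj⟩ := exists_disjoint_of_card_lt
    (h.sunflower.subset fun x hx => by simpa using (Finset.mem_filter.1 hx).1) hpetals
  rw [Finset.mem_filter, List.mem_toFinset] at hx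
  refine ⟨x, List.mem_toFinset.2 hx.1, hx.2, hle.trans ?_⟩
  conv_lhs => rw [← Finset.insert_erase heB]
  rw [coverage_insert, coverage_insert]
  exact card_union_le_card_union_of_disjoint (he.card_eq.trans (h.card_eq x hx.1).symm)
    (he.trace_eq.trans (h.trace_eq x hx.1).symm) hdisj

end Nodes

/-! ### Marginal values -/

section Marginal

variable {U : Type} [DecidableEq U]

theorem card_sdiff_eq_card_sdiff_union_iff (s t c : Finset U) :
    (s \ c).card = (s \ (t ∪ c)).card ↔ Disjoint (s \ c) t := by
  rw [Finset.union_comm, ← Finset.sup_eq_union, ← sdiff_sdiff_left,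
    ← Finset.sdiff_eq_self_iff_disjoint]
  exact ⟨fun h => Finset.eq_of_subset_of_card_le Finset.sdiff_subset h.le, fun h => by rw [h]⟩

theorem card_sdiff_eq_and_eq_iff_inter_eq (s t c : Finset U) :
    (s \ t).card = (s \ c).card ∧ (s \ c).card = (s \ (t ∪ c)).card ↔ s ∩ t = s ∩ c := by
  constructor
  · rintro ⟨htc, hunion⟩
    have hc : s \ (t ∪ c) = s \ c := Finset.eq_of_subset_of_card_le
      (Finset.sdiff_subset_sdiff le_rfl Finset.subset_union_right) hunion.le
    have ht : s \ (t ∪ c) = s \ t := Finset.eq_of_subset_of_card_le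
      (Finset.sdiff_subset_sdiff le_rfl Finset.subset_union_left) (htc.trans hunion).le
    rw [← Finset.sdiff_sdiff_self_left, ← ht, hc, Finset.sdiff_sdiff_self_left]
  · intro h
    have hsdiff : s \ t = s \ c := by
      rw [← Finset.sdiff_inter_self_left, h, Finset.sdiff_inter_self_left]
    rw [Finset.sdiff_union_distrib, hsdiff, Finset.inter_self]
    exact ⟨rfl, rfl⟩

variable {X ι : Type} {A : Setup X ι} {I : ι → Finset X → Bool} {P : X → Finset U}

/-- The points that an optional element covers; the dummy element covers none. -/
def cover (P : X → Finset U) (p : Option X) : Finset U := p.toFinset.biUnion P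

theorem cover_none (P : X → Finset U) : cover P none = ∅ := rfl

theorem cover_some (P : X → Finset U) (p : X) : cover P (some p) = P p := by
  rw [cover, Option.toFinset_some, Finset.singleton_biUnion]

theorem coverage_le_mul {k z : ℕ} {S : Finset X} (hS : S.card ≤ k)
    (h : ∀ x ∈ S, (P x).card ≤ z) : coverage P S ≤ k * z :=
  (Finset.card_biUnion_le_card_mul _ _ z h).trans (Nat.mul_le_mul_right z hS)

variable [DecidableEq X]

theorem meets_marginal (I : ι → Finset X → Bool) (x : X) (S : Finset X) :
    Meets (coverage P) I (marginal x S) (· = ((P x \ S.biUnion P).card : ℤ)) 2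
      (coverage P (insert x S)) := by
  refine .bind (q₁ := 1) (q₂ := 1) (.value (post := (· = coverage P (insert x S))) rfl le_rfl) ?_
    le_rfl
  rintro _ rfl
  refine .bind (q₁ := 1) (q₂ := 0) (.hold (b' := 0)
    (Meets.value (post := (· = coverage P S)) rfl le_rfl) (size_le_self _)) ?_ le_rfl
  rintro _ rfl
  refine .pure ?_
  rw [coverage_insert, ← Finset.card_sdiff_add_card, coverage]
  push_cast
  ring

theorem meets_marginal_of_card_le {x : X} {S : Finset X} {z : ℕ} (hx : (P x).card ≤ z)
    (hS : ∀ y ∈ S, (P y).card ≤ z) (hcard : S.card ≤ 2) :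
    Meets (coverage P) I (marginal x S)
      (fun a => a = ((P x \ S.biUnion P).card : ℤ) ∧ a.natAbs.size ≤ z) 2 (3 * z) := by
  refine (meets_marginal I x S).mono (fun a ha => ⟨ha, ?_⟩) le_rfl
    (coverage_le_mul ((Finset.card_insert_le x S).trans (Nat.succ_le_succ hcard))
      (Finset.forall_mem_insert _ _ _ |>.2 ⟨hx, hS⟩))
  rw [ha, Int.natAbs_natCast]
  exact (size_le_self _).trans ((Finset.card_le_card Finset.sdiff_subset).trans hx)

theorem meets_firstClash {e : X} {p : Option X} {rs : List X} (he : (P e).card ≤ A.z)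
    (hp : ∀ x ∈ p, (P x).card ≤ A.z) (hrs : ∀ r ∈ rs, (P r).card ≤ A.z) :
    Meets (coverage P) I (firstClash A e p rs)
      (· = rs.find? fun r => ¬ Disjoint (P e \ cover P p) (P r)) (4 * rs.length)
      (compareBits A) := by
  induction rs with
  | nil => exact .pure rfl
  | cons r rs ih =>
    rw [List.forall_mem_cons] at hrs
    have hp' : ∀ x ∈ p.toFinset, (P x).card ≤ A.z := fun x hx => hp x (Option.mem_toFinset.1 hx)
    have hcard : p.toFinset.card ≤ 1 := by cases p <;> simp
    have hclash := card_sdiff_eq_card_sdiff_union_iff (P e) (P r) (cover P p)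
    rw [firstClash, List.length_cons, compareBits]
    refine .bind (q₁ := 2) (q₂ := 4 * rs.length + 2)
      (.hold (meets_marginal_of_card_le he hp' (hcard.trans one_le_two)) (by lia)) ?_ (by lia)
    rintro a ⟨ha, hsize⟩
    refine .bind (q₁ := 2) (q₂ := 4 * rs.length)
      (.hold (meets_marginal_of_card_le he (Finset.forall_mem_insert _ _ _ |>.2 ⟨hrs.1, hp'⟩)
        ((Finset.card_insert_le _ _).trans (Nat.succ_le_succ hcard))) (by lia)) ?_ (by lia)
    rintro b ⟨hb, -⟩
    have hab : a = b ↔ Disjoint (P e \ cover P p) (P r) := by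
      rw [ha, hb, Nat.cast_inj, Finset.biUnion_insert]
      exact hclash
    split_ifs with hne
    · exact .pure (by simp [← hab, hne])
    · exact (ih hrs.2).mono (fun o ho => by simp [ho, ← hab, not_not.1 hne]) le_rfl le_rfl

theorem meets_sameTrace {e r : X} {rs : List X} (he : (P e).card ≤ A.z) (hr : (P r).card ≤ A.z)
    (hrs : ∀ r' ∈ rs, (P r').card ≤ A.z) :
    Meets (coverage P) I (sameTrace A e r rs)
      (· = decide (∀ r' ∈ rs, P r ∩ P r' = P r ∩ P e)) (6 * rs.length) (compareBits A) := by
  induction rs with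
  | nil => exact .pure (by simp)
  | cons r' rs ih =>
    rw [List.forall_mem_cons] at hrs
    have htrace := card_sdiff_eq_and_eq_iff_inter_eq (P r) (P r') (P e)
    rw [sameTrace, List.length_cons, compareBits]
    refine .bind (q₁ := 2) (q₂ := 6 * rs.length + 4)
      (.hold (meets_marginal_of_card_le hr (S := {r'}) (by simpa using hrs.1) (by simp))
        (by lia)) ?_ (by lia)
    rintro a ⟨ha, ha_size⟩
    refine .bind (q₁ := 2) (q₂ := 6 * rs.length + 2)
      (.hold (meets_marginal_of_card_le hr (S := {e}) (by simpa using he) (by simp))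
        (by lia)) ?_ (by lia)
    rintro b ⟨hb, hb_size⟩
    refine .bind (q₁ := 2) (q₂ := 6 * rs.length)
      (.hold (meets_marginal_of_card_le hr (S := {r', e}) (by simpa using ⟨hrs.1, he⟩)
        Finset.card_le_two) (by lia)) ?_ (by lia)
    rintro c ⟨hc, -⟩
    have habc : (a = b ∧ b = c) ↔ P r ∩ P r' = P r ∩ P e := by
      simpa [ha, hb, hc, Finset.biUnion_insert] using htrace
    split_ifs with heq
    · exact (ih hrs.2).mono (fun o ho => by simp [ho, habc.1 heq]) le_rfl le_rfl
    · exact .pure (by simp [mt habc.2 heq])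

end Marginal

/-! ### The trees -/

section Bounds

variable {X ι : Type}

/-- The maximal number of elements that are stored at a node. -/
def nodeBound (A : Setup X ι) : ℕ := A.z * setBound A

/-- A bound on the number of nodes of a tree with at most `K` elements per node, whose elements
cover at most `m` points: a node has at most `K` times `2 ^ m - 1` children, and passing to a child
decreases the number of points outside of the trace. -/
def treeBound (K m : ℕ) : ℕ := K ^ m * 2 ^ (m + 1).choose 2

theorem treeBound_zero (K : ℕ) : treeBound K 0 = 1 := by simp [treeBound]

theorem treeBound_succ (K m : ℕ) :
    treeBound K (m + 1) = K * 2 ^ (m + 1) * treeBound K m := by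
  rw [treeBound, treeBound, Nat.choose_succ_succ' (m + 1), Nat.choose_one_right]
  ring

theorem one_le_treeBound {K : ℕ} (hK : 1 ≤ K) (m : ℕ) : 1 ≤ treeBound K m :=
  Nat.mul_pos (Nat.pow_pos hK) (Nat.two_pow_pos _)

theorem treeBound_mono {K : ℕ} (hK : 1 ≤ K) : Monotone (treeBound K) := fun _ _ h =>
  Nat.mul_le_mul (Nat.pow_le_pow_right hK h)
    (Nat.pow_le_pow_right two_pos (Nat.choose_le_choose 2 (Nat.succ_le_succ h)))

/-- The number of nodes of a forest. -/
def Forest.nodes : Forest X → ℕ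
  | .nil => 0
  | .cons _ _ ch sib => ch.nodes + 1 + sib.nodes

/-- The memory in which a node is stored. -/
def nodeBits (A : Setup X ι) : ℕ := nodeBound A * (A.elemBits + 1) + A.z + A.elemBits + 2

theorem setsBits_eq (b : ℕ) (sets : List (List X)) :
    setsBits b sets = sets.flatten.length * (b + 1) + sets.length := by
  induction sets with
  | nil => simp [setsBits]
  | cons R Rs ih =>
    rw [setsBits] at ih
    rw [setsBits, List.map_cons, List.sum_cons, ih, List.flatten_cons, List.length_append,
      List.length_cons]
    ring

end Bounds

section NodeSize

variable {X ι U : Type} [DecidableEq X] [DecidableEq ι] [DecidableEq U] {A : Setup X ι}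
  {I : ι → Finset X → Bool} {P : X → Finset U} {j : ℕ} {C Q : Finset U} {sets : List (List X)}

theorem NodeInv.subset (h : NodeInv A I P j C Q sets) : ∀ r ∈ sets.flatten, Q ⊆ P r := fun r hr =>
  h.trace_eq r hr ▸ Finset.inter_subset_left

theorem NodeInv.length_le (hA : ∀ e, (A.grounds e).length ≤ A.ℓ) (h : NodeInv A I P j C Q sets) :
    ∀ R ∈ sets, R.length ≤ setBound A := fun R hR =>
  (h.stable R hR).length_le hA ((List.nodup_flatten.1 h.nodup).1 R hR)

theorem NodeInv.length_flatten_le (hA : ∀ e, (A.grounds e).length ≤ A.ℓ)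
    (h : NodeInv A I P j C Q sets) : sets.flatten.length ≤ nodeBound A := by
  rw [nodeBound, ← h.length_eq]
  exact Coverage.length_flatten_le (h.length_le hA)

theorem NodeInv.setsBits_le (hA : ∀ e, (A.grounds e).length ≤ A.ℓ)
    (h : NodeInv A I P j C Q sets) :
    setsBits A.elemBits sets + A.elemBits + 2 ≤ nodeBits A := by
  have := Nat.mul_le_mul_right (A.elemBits + 1) (h.length_flatten_le hA)
  rw [setsBits_eq, h.length_eq, nodeBits]
  lia

end NodeSize

section Forest

variable {X ι U : Type} [DecidableEq X] [DecidableEq U]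

/-- The common trace on `P p` of the elements of a node with parent element `p`. -/
def trace (P : X → Finset U) (p : X) (sets : List (List X)) : Finset U :=
  P p ∩ sets.flatten.toFinset.biUnion P

/-- The pairs of a parent element and the trace on it by which siblings are distinguished. -/
def Forest.keys (P : X → Finset U) : Forest X → List (X × Finset U)
  | .nil => []
  | .cons p sets _ sib => (p, trace P p sets) :: sib.keys P

variable [DecidableEq ι] {A : Setup X ι} {I : ι → Finset X → Bool} {P : X → Finset U} {j : ℕ}

/-- The invariant of the children of a node that stores the elements `S` with trace `Q`. -/
inductive ForestInv (A : Setup X ι) (I : ι → Finset X → Bool) (P : X → Finset U) (j : ℕ) :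
    List X → Finset U → Forest X → Prop
  | nil {S : List X} {Q : Finset U} : ForestInv A I P j S Q .nil
  | cons {S : List X} {Q T : Finset U} {p : X} {sets : List (List X)} {ch sib : Forest X}
    (parent_mem : p ∈ S) (ssubset : Q ⊂ T) (ne_nil : sets.flatten ≠ [])
    (node : NodeInv A I P j (P p) T sets) (children : ForestInv A I P j sets.flatten T ch)
    (fresh : (p, T) ∉ sib.keys P) (siblings : ForestInv A I P j S Q sib) :
    ForestInv A I P j S Q (.cons p sets ch sib)

variable {C Q : Finset U} {S : List X} {sets : List (List X)} {F ch : Forest X}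

theorem ForestInv.mono {S' : List X} (h : ForestInv A I P j S Q F) (hS : S ⊆ S') :
    ForestInv A I P j S' Q F := by
  induction h with
  | nil => exact .nil
  | cons hp hQ hne hN hch hfresh _ _ ih => exact .cons (hS hp) hQ hne hN hch hfresh (ih hS)

theorem NodeInv.trace_eq_of_ne_nil {p : X} (h : NodeInv A I P j (P p) Q sets)
    (hne : sets.flatten ≠ []) : trace P p sets = Q := by
  obtain ⟨r, hr⟩ := List.exists_mem_of_ne_nil _ hne
  have hPr (x : X) (hx : x ∈ sets.flatten.toFinset) : P p ∩ P x = Q := by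
    rw [Finset.inter_comm, h.trace_eq x (List.mem_toFinset.1 hx)]
  rw [trace, Finset.inter_biUnion, Finset.biUnion_congr rfl hPr, ← Finset.sup_eq_biUnion]
  exact Finset.sup_const ⟨r, List.mem_toFinset.2 hr⟩ Q

theorem NodeInv.keys_cons {p : X} (h : NodeInv A I P j (P p) Q sets) (hne : sets.flatten ≠ [])
    (ch sib : Forest X) : (Forest.cons p sets ch sib).keys P = (p, Q) :: sib.keys P := by
  rw [Forest.keys, h.trace_eq_of_ne_nil hne]

theorem ForestInv.nodup_keys (h : ForestInv A I P j S Q F) : (F.keys P).Nodup := by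
  induction h with
  | nil => exact List.nodup_nil
  | cons _ _ hne hN _ hfresh _ _ ih =>
    rw [hN.keys_cons hne]
    exact List.nodup_cons.2 ⟨hfresh, ih⟩

theorem ForestInv.mem_keys (h : ForestInv A I P j S Q F) :
    ∀ k ∈ F.keys P, k.1 ∈ S ∧ k.2 ∈ Finset.Ioc Q (P k.1) := by
  induction h with
  | nil => simp [Forest.keys]
  | cons hp hQ hne hN _ _ _ _ ih =>
    rw [hN.keys_cons hne]
    refine List.forall_mem_cons.2 ⟨⟨hp, Finset.mem_Ioc.2 ⟨hQ, ?_⟩⟩, ih⟩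
    rw [← hN.trace_eq_of_ne_nil hne]
    exact Finset.inter_subset_left

theorem ForestInv.length_keys_le (h : ForestInv A I P j S Q F)
    (hS : ∀ r ∈ S, (P r).card = j ∧ Q ⊆ P r) :
    (F.keys P).length ≤ S.length * (2 ^ (j - Q.card) - 1) := by
  have hsub : (F.keys P).toFinset ⊆ (S.toFinset.sigma fun r => Finset.Ioc Q (P r)).map
      (Equiv.sigmaEquivProd X (Finset U)).toEmbedding := fun k hk => by
    simpa using h.mem_keys k (List.mem_toFinset.1 hk)
  calc (F.keys P).length = (F.keys P).toFinset.card :=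
        (List.toFinset_card_of_nodup h.nodup_keys).symm
    _ ≤ ∑ r ∈ S.toFinset, (Finset.Ioc Q (P r)).card := by
        rw [← Finset.card_sigma, ← Finset.card_map (Equiv.sigmaEquivProd X (Finset U)).toEmbedding]
        exact Finset.card_le_card hsub
    _ ≤ S.toFinset.card * (2 ^ (j - Q.card) - 1) := Finset.sum_le_card_nsmul _ _ _ fun r hr => by
        obtain ⟨hcard, hQ⟩ := hS r (List.mem_toFinset.1 hr)
        rw [← hcard, Finset.card_Ioc_finset hQ]
    _ ≤ S.length * (2 ^ (j - Q.card) - 1) := Nat.mul_le_mul_right _ (List.toFinset_card_le S)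

theorem NodeInv.length_keys_le (hA : ∀ e, (A.grounds e).length ≤ A.ℓ)
    (h : NodeInv A I P j C Q sets) (hch : ForestInv A I P j sets.flatten Q ch) {m : ℕ}
    (hm : j ≤ Q.card + m) : (ch.keys P).length ≤ nodeBound A * (2 ^ m - 1) :=
  (hch.length_keys_le fun r hr => ⟨h.card_eq r hr, h.subset r hr⟩).trans
    (Nat.mul_le_mul (h.length_flatten_le hA)
      (Nat.sub_le_sub_right (Nat.pow_le_pow_right two_pos (Nat.sub_le_iff_le_add'.2 hm)) 1))

theorem NodeInv.nodes_lt_treeBound (hA : ∀ e, (A.grounds e).length ≤ A.ℓ) (hz : 1 ≤ nodeBound A)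
    (h : NodeInv A I P j C Q sets) (hch : ForestInv A I P j sets.flatten Q ch)
    (hnodes : ∀ m, j ≤ Q.card + (m + 1) →
      ch.nodes ≤ (ch.keys P).length * treeBound (nodeBound A) m)
    {m : ℕ} (hm : j ≤ Q.card + m) : ch.nodes + 1 ≤ treeBound (nodeBound A) m := by
  have hkeys := h.length_keys_le hA hch hm
  cases m with
  | zero =>
    have hzero := hnodes 0 (hm.trans (Nat.le_succ _))
    rw [treeBound_zero] at hzero ⊢
    lia
  | succ m =>
    set K := nodeBound A
    have hK : 1 ≤ K * treeBound K m := Nat.mul_pos hz (one_le_treeBound hz m)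
    have hpow := Nat.sub_add_cancel (Nat.one_le_two_pow (n := m + 1))
    calc ch.nodes + 1 ≤ K * (2 ^ (m + 1) - 1) * treeBound K m + K * treeBound K m :=
          Nat.add_le_add ((hnodes m hm).trans (Nat.mul_le_mul_right _ hkeys)) hK
      _ = K * (2 ^ (m + 1) - 1 + 1) * treeBound K m := by ring
      _ = treeBound K (m + 1) := by rw [hpow, treeBound_succ]

theorem ForestInv.nodes_le (hA : ∀ e, (A.grounds e).length ≤ A.ℓ) (hz : 1 ≤ nodeBound A)
    (h : ForestInv A I P j S Q F) (m : ℕ) (hm : j ≤ Q.card + (m + 1)) :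
    F.nodes ≤ (F.keys P).length * treeBound (nodeBound A) m := by
  induction h generalizing m with
  | nil => exact Nat.zero_le _
  | cons _ hQ _ hN hch _ _ ih_ch ih_sib =>
    have hlt := Finset.card_lt_card hQ
    have hsubtree := hN.nodes_lt_treeBound hA hz hch ih_ch (m := m) (by lia)
    have hsib := ih_sib m hm
    rw [Forest.nodes, Forest.keys, List.length_cons]
    lia

theorem ForestInv.card_elems_le (hA : ∀ e, (A.grounds e).length ≤ A.ℓ)
    (h : ForestInv A I P j S Q F) : F.elems.card ≤ F.nodes * nodeBound A := by
  induction h with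
  | nil => simp [Forest.elems]
  | @cons _ _ _ _ sets ch sib _ _ _ hN _ _ _ ih_ch ih_sib =>
    have hsets := (List.toFinset_card_le sets.flatten).trans (hN.length_flatten_le hA)
    have hunion := Finset.card_union_le (sets.flatten.toFinset ∪ ch.elems) sib.elems
    have hunion' := Finset.card_union_le sets.flatten.toFinset ch.elems
    rw [Forest.elems, Forest.nodes]
    lia

theorem ForestInv.bits_le (hA : ∀ e, (A.grounds e).length ≤ A.ℓ)
    (h : ForestInv A I P j S Q F) : F.bits A.elemBits ≤ F.nodes * nodeBits A + 1 := by
  induction h with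
  | nil => simp [Forest.bits]
  | cons _ _ _ hN _ _ _ ih_ch ih_sib =>
    have hsets := hN.setsBits_le hA
    rw [Forest.bits, Forest.nodes]
    lia

end Forest

section Tree

variable {X ι U : Type} [DecidableEq X] [DecidableEq ι] [DecidableEq U] {A : Setup X ι}
  {I : ι → Finset X → Bool} {P : X → Finset U} {j : ℕ} {t : Tree X}

/-- The invariant of the tree of the elements that cover `j` points. -/
structure TreeInv (A : Setup X ι) (I : ι → Finset X → Bool) (P : X → Finset U) (j : ℕ)
    (t : Tree X) : Prop where
  node : NodeInv A I P j ∅ ∅ t.sets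
  forest : ForestInv A I P j t.sets.flatten ∅ t.children

theorem treeInv_emptyTree (A : Setup X ι) (I : ι → Finset X → Bool) (P : X → Finset U) (j : ℕ) :
    TreeInv A I P j (emptyTree A.z) :=
  ⟨nodeInv_replicate A I P j ∅ ∅, .nil⟩

theorem TreeInv.nodes_lt_treeBound (hA : ∀ e, (A.grounds e).length ≤ A.ℓ) (hz : 1 ≤ nodeBound A)
    (h : TreeInv A I P j t) : t.children.nodes + 1 ≤ treeBound (nodeBound A) j :=
  h.node.nodes_lt_treeBound hA hz h.forest (h.forest.nodes_le hA hz) (Nat.le_add_left j _)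

theorem TreeInv.card_elems_le (hA : ∀ e, (A.grounds e).length ≤ A.ℓ) (hz : 1 ≤ nodeBound A)
    (h : TreeInv A I P j t) : t.elems.card ≤ nodeBound A * treeBound (nodeBound A) j := by
  have hsets := (List.toFinset_card_le t.sets.flatten).trans (h.node.length_flatten_le hA)
  have hchildren := h.forest.card_elems_le hA
  have hnodes := Nat.mul_le_mul_left (nodeBound A) (h.nodes_lt_treeBound hA hz)
  have hunion := Finset.card_union_le t.sets.flatten.toFinset t.children.elems
  rw [Tree.elems]
  lia

theorem TreeInv.bits_le (hA : ∀ e, (A.grounds e).length ≤ A.ℓ) (hz : 1 ≤ nodeBound A)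
    (h : TreeInv A I P j t) : t.bits A.elemBits ≤ treeBound (nodeBound A) j * nodeBits A := by
  have hsets := h.node.setsBits_le hA
  have hchildren := h.forest.bits_le hA
  have hnodes := Nat.mul_le_mul_right (nodeBits A) (h.nodes_lt_treeBound hA hz)
  rw [Tree.bits]
  lia

end Tree

section Insertion

variable {X ι U : Type} [DecidableEq X] [DecidableEq ι] [DecidableEq U]

/-- The effect of the insertion of `e` below a node with the sets `sets` and the children `ch`; the
pair `out` consists of the new sets and the new children. -/
structure VisitSpec (A : Setup X ι) (M : ι → Matroid X) (P : X → Finset U) (j : ℕ)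
    (C Q : Finset U) (e : X) (sets : List (List X)) (ch : Forest X)
    (out : List (List X) × Forest X) : Prop where
  node : NodeInv A (indepOracle M) P j C Q out.1
  forest : ForestInv A (indepOracle M) P j out.1.flatten Q out.2
  grows_sets : Grows e sets.flatten.toFinset out.1.flatten.toFinset
  grows_children : Grows e ch.elems out.2.elems
  substitutable : Substitutable M P A.z e (out.1.flatten.toFinset ∪ out.2.elems)

/-- The effect of the insertion of `e` below those children of a node that are associated with its
element `r`; the forest `F` of all children becomes `F'`. -/
structure PlaceSpec (A : Setup X ι) (M : ι → Matroid X) (P : X → Finset U) (j : ℕ)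
    (S : List X) (Q : Finset U) (e r : X) (F F' : Forest X) : Prop where
  forest : ForestInv A (indepOracle M) P j S Q F'
  keys_subset : F'.keys P ⊆ (r, P e ∩ P r) :: F.keys P
  grows : Grows e F.elems F'.elems
  substitutable : Substitutable M P A.z e F'.elems

variable {A : Setup X ι} {M : ι → Matroid X} {P : X → Finset U} {j : ℕ} {C Q T : Finset U}
  {sets : List (List X)} {ch sib : Forest X} {e p r : X} {S : List X}

theorem VisitSpec.insertSets (hA : Presents A M) (h : NodeInv A (indepOracle M) P j C Q sets)
    (he : Reaches P j C Q sets e) (hch : ForestInv A (indepOracle M) P j sets.flatten Q ch)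
    (hd : ∀ r ∈ sets.flatten, Disjoint (P e \ C) (P r)) :
    VisitSpec A M P j C Q e sets ch (insertSets A (indepOracle M) e sets, ch) :=
  have hgrows := grows_insertSets A (indepOracle M) sets e
  { node := h.add he hd
    forest := hch.mono fun _ hx => List.mem_toFinset.1 (hgrows.subset (List.mem_toFinset.2 hx))
    grows_sets := hgrows
    grows_children := .refl e _
    substitutable := (h.substitutable hA he).mono Finset.subset_union_left }

theorem PlaceSpec.visitSpec {ch' : Forest X} (hch : PlaceSpec A M P j sets.flatten Q e r ch ch')
    (h : NodeInv A (indepOracle M) P j C Q sets) :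
    VisitSpec A M P j C Q e sets ch (sets, ch') where
  node := h
  forest := hch.forest
  grows_sets := .refl e _
  grows_children := hch.grows
  substitutable := hch.substitutable.mono Finset.subset_union_right

theorem placeSpec_nil (hz : 1 ≤ A.z) (hr : r ∈ S) (hcard : (P e).card = j)
    (hQ : Q ⊂ P e ∩ P r) :
    PlaceSpec A M P j S Q e r .nil
      (.cons r (insertSets A (indepOracle M) e (List.replicate A.z [])) .nil .nil) := by
  have hflat := flatten_insertSets_replicate (A := A) (I := indepOracle M) (e := e) hz
  have hne := hflat ▸ List.cons_ne_nil e []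
  have hnode : NodeInv A (indepOracle M) P j (P r) (P e ∩ P r)
      (insertSets A (indepOracle M) e (List.replicate A.z [])) :=
    (nodeInv_replicate A _ P j _ _).add ⟨by simp, hcard, rfl⟩ (by simp)
  have helems : (Forest.cons r (insertSets A (indepOracle M) e (List.replicate A.z [])) .nil
      .nil).elems = {e} := by
    simp [Forest.elems, hflat]
  refine ⟨.cons hr hQ hne hnode .nil List.not_mem_nil .nil, ?_, ?_, ?_⟩
  · rw [hnode.keys_cons hne]
    exact List.Subset.refl _
  · rw [helems]
    exact ⟨Finset.empty_subset _, subset_rfl⟩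
  · rw [helems]
    exact .of_mem (Finset.mem_singleton_self e)

theorem VisitSpec.placeSpec {out : List (List X) × Forest X}
    (h : VisitSpec A M P j (P p) T e sets ch out) (hp : p ∈ S) (hQ : Q ⊂ T)
    (hne : sets.flatten ≠ []) (hnode : NodeInv A (indepOracle M) P j (P p) T sets)
    (hfresh : (p, T) ∉ sib.keys P) (hsib : ForestInv A (indepOracle M) P j S Q sib) :
    PlaceSpec A M P j S Q e p (.cons p sets ch sib) (.cons p out.1 out.2 sib) := by
  have hne' : out.1.flatten ≠ [] := by
    rw [← List.toFinset_nonempty_iff] at hne ⊢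
    exact hne.mono h.grows_sets.subset
  refine ⟨.cons hp hQ hne' h.node h.forest hfresh hsib, ?_,
    (h.grows_sets.union h.grows_children).union (.refl e _),
    h.substitutable.mono Finset.subset_union_left⟩
  rw [h.node.keys_cons hne', hnode.keys_cons hne]
  exact List.subset_cons_self _ _

theorem PlaceSpec.cons {sib' : Forest X} (h : PlaceSpec A M P j S Q e r sib sib') (hp : p ∈ S)
    (hQ : Q ⊂ T) (hne : sets.flatten ≠ [])
    (hnode : NodeInv A (indepOracle M) P j (P p) T sets)
    (hch : ForestInv A (indepOracle M) P j sets.flatten T ch) (hfresh : (p, T) ∉ sib.keys P)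
    (hfit : ¬ (p = r ∧ P e ∩ P r = T)) :
    PlaceSpec A M P j S Q e r (.cons p sets ch sib) (.cons p sets ch sib') := by
  have hfresh' : (p, T) ∉ sib'.keys P := fun hmem =>
    (List.mem_cons.1 (h.keys_subset hmem)).elim
      (fun heq => hfit ⟨congrArg Prod.fst heq, (congrArg Prod.snd heq).symm⟩) hfresh
  refine ⟨.cons hp hQ hne hnode hch hfresh' h.forest, ?_, (Grows.refl e _).union h.grows,
    h.substitutable.mono Finset.subset_union_right⟩
  rw [hnode.keys_cons hne, hnode.keys_cons hne]
  exact List.Subset.trans (List.cons_subset_cons _ h.keys_subset) (List.Perm.swap _ _ _).subset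

theorem NodeInv.ssubset_of_clash (h : NodeInv A (indepOracle M) P j C Q sets)
    (he : Reaches P j C Q sets e) (hr : r ∈ sets.flatten) (hclash : ¬ Disjoint (P e \ C) (P r)) :
    Q ⊂ P e ∩ P r := by
  obtain ⟨u, hue, hur⟩ := Finset.not_disjoint_iff.1 hclash
  rw [Finset.mem_sdiff] at hue
  refine Finset.ssubset_iff_subset_ne.2
    ⟨Finset.subset_inter (he.trace_eq ▸ Finset.inter_subset_left) (h.subset r hr), ?_⟩
  rintro rfl
  exact hue.2 (Finset.mem_of_mem_inter_right
    (he.trace_eq ▸ Finset.mem_inter.2 ⟨hue.1, hur⟩ : u ∈ P e ∩ C))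

theorem NodeInv.forall_inter_eq_iff (h : NodeInv A (indepOracle M) P j (P p) T sets)
    (hne : sets.flatten ≠ []) :
    (∀ r' ∈ sets.flatten, P p ∩ P r' = P p ∩ P e) ↔ P e ∩ P p = T := by
  rw [Finset.inter_comm (P e)]
  constructor
  · intro hall
    obtain ⟨r', hr'⟩ := List.exists_mem_of_ne_nil _ hne
    rw [← hall r' hr', Finset.inter_comm, h.trace_eq r' hr']
  · rintro rfl r' hr'
    rw [Finset.inter_comm, h.trace_eq r' hr']

theorem meets_visit (hA : Presents A M) {p : Option X} (hC : cover P p = C)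
    (hp : ∀ x ∈ p, (P x).card ≤ A.z) (hj : j ≤ A.z)
    (h : NodeInv A (indepOracle M) P j C Q sets) (he : Reaches P j C Q sets e)
    (hch : ForestInv A (indepOracle M) P j sets.flatten Q ch) {descend : X → OProg X ι (Forest X)}
    {q n : ℕ} (hdescend : ∀ r ∈ sets.flatten, Q ⊂ P e ∩ P r →
      Meets (coverage P) (indepOracle M) (descend r) (PlaceSpec A M P j sets.flatten Q e r ch) q
        (workBits A + n)) :
    Meets (coverage P) (indepOracle M) (visit A e p sets ch descend)
      (VisitSpec A M P j C Q e sets ch) (4 * nodeBound A + q)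
      (workBits A + (n + (A.elemBits + 1))) := by
  subst hC
  have hcompare : compareBits A ≤ workBits A := Nat.le_add_right _ _
  have hlen := h.length_flatten_le hA.length_grounds_le
  rw [visit]
  refine .bind ((meets_firstClash (he.card_eq.trans_le hj) hp fun r hr =>
    (h.card_eq r hr).trans_le hj).mono (fun _ => id) (Nat.mul_le_mul_left 4 hlen) (by lia)) ?_
    le_rfl
  rintro o rfl
  cases hclash : sets.flatten.find? fun r => ¬ Disjoint (P e \ cover P p) (P r) with
  | none =>
    refine .bind₀ ((meets_processElem hA.length_grounds_le _ e h.stable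
      (h.length_le hA.length_grounds_le)).mono (fun _ => id) le_rfl (by lia)) ?_
    rintro _ rfl
    exact .pure (.insertSets hA h he hch fun r hr => by
      simpa using List.find?_eq_none.1 hclash r hr)
  | some r =>
    have hr := List.mem_of_find?_eq_some hclash
    have hQ := h.ssubset_of_clash he hr (by simpa using List.find?_some hclash)
    exact .bind ((hdescend r hr hQ).hold (by lia)) (fun _ hs => .pure (hs.visitSpec h))
      (Nat.add_zero q).le

theorem meets_place (hA : Presents A M) (hz : 1 ≤ A.z) (hj : j ≤ A.z) (hcard : (P e).card = j)
    {F : Forest X} (h : ForestInv A (indepOracle M) P j S Q F) (hS : ∀ r ∈ S, (P r).card ≤ A.z)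
    (he : e ∉ F.elems) (hr : r ∈ S) (hQ : Q ⊂ P e ∩ P r) :
    Meets (coverage P) (indepOracle M) (place A e r F) (PlaceSpec A M P j S Q e r F)
      (10 * (nodeBound A * F.nodes)) (workBits A + F.nodes * (A.elemBits + 1)) := by
  induction h generalizing r with
  | nil =>
    refine .bind₀ ((meets_processElem hA.length_grounds_le _ e
      (nodeInv_replicate A _ P j ∅ ∅).stable (by simp)).mono (fun _ => id) le_rfl (by lia)) ?_
    rintro _ rfl
    exact .pure (placeSpec_nil hz hr hcard hQ)
  | @cons S Q T p sets ch sib hp hQT hne hnode hch hfresh hsib ih_ch ih_sib =>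
    have hcompare : compareBits A ≤ workBits A := Nat.le_add_right _ _
    have hlen := hnode.length_flatten_le hA.length_grounds_le
    have hchild : ∀ r' ∈ sets.flatten, (P r').card ≤ A.z := fun r' hr' =>
      (hnode.card_eq r' hr').trans_le hj
    simp only [Forest.elems, Finset.mem_union, List.mem_toFinset, not_or] at he
    have hnotfit (hfit : ¬ (p = r ∧ P e ∩ P r = T)) : Meets (coverage P) (indepOracle M)
        (do let sib' ← OProg.hold 1 (place A e r sib); pure (Forest.cons p sets ch sib'))
        (PlaceSpec A M P j S Q e r (.cons p sets ch sib)) (10 * (nodeBound A * sib.nodes))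
        (workBits A + (ch.nodes + 1 + sib.nodes) * (A.elemBits + 1)) :=
      .bind (.hold (ih_sib hS he.2 hr hQ) (by lia))
        (fun sib' hs => .pure (hs.cons hp hQT hne hnode hch hfresh hfit)) (Nat.add_zero _).le
    rw [place, Forest.nodes]
    split_ifs with hpr
    · subst hpr
      refine .bind (q₂ := 4 * nodeBound A + 10 * (nodeBound A * (ch.nodes + sib.nodes)))
        ((meets_sameTrace (hcard.trans_le hj) (hS p hp) hchild).mono (fun _ => id)
          (Nat.mul_le_mul_left 6 hlen) (by lia)) ?_ (by lia)
      rintro _ rfl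
      simp only [hnode.forall_inter_eq_iff hne, decide_eq_true_eq]
      split_ifs with hfit
      · exact .bind (q₂ := 0) ((meets_visit hA (cover_some P p) (by simpa using hS p hp) hj hnode
          ⟨he.1.1, hcard, hfit⟩ hch fun r' hr' hQ' => ih_ch hchild he.1.2 hr' hQ').mono
            (fun _ => id) le_rfl (by lia))
          (fun out hout => .pure (hout.placeSpec hp hQT hne hnode hfresh hsib)) (by lia)
      · exact (hnotfit fun h => hfit h.2).mono (fun _ => id) (by lia) le_rfl
    · exact .bind₀ (.pure (post := (· = false)) rfl) (by
        rintro _ rfl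
        exact (hnotfit fun h => hpr h.1).mono (fun _ => id) (by lia) le_rfl)

/-- The effect of the insertion of `e` into a tree. -/
structure InsertSpec (A : Setup X ι) (M : ι → Matroid X) (P : X → Finset U) (j : ℕ) (e : X)
    (t t' : Tree X) : Prop where
  tree : TreeInv A (indepOracle M) P j t'
  grows : Grows e t.elems t'.elems
  substitutable : Substitutable M P A.z e t'.elems

theorem meets_insertElem (hA : Presents A M) (hz : 1 ≤ A.z) (hj : j ≤ A.z)
    (hcard : (P e).card = j) {t : Tree X} (h : TreeInv A (indepOracle M) P j t)
    (he : e ∉ t.elems) :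
    Meets (coverage P) (indepOracle M) (insertElem A e t) (InsertSpec A M P j e t)
      (10 * (nodeBound A * (t.children.nodes + 1)))
      (workBits A + (t.children.nodes + 1) * (A.elemBits + 1)) := by
  simp only [Tree.elems, Finset.mem_union, List.mem_toFinset, not_or] at he
  refine .bind (q₂ := 0) ((meets_visit hA (cover_none P) (by simp) hj h.node
    ⟨he.1, hcard, Finset.inter_empty _⟩ h.forest fun r hr hQ =>
      meets_place hA hz hj hcard h.forest (fun x hx => (h.node.card_eq x hx).trans_le hj) he.2
        hr hQ).mono (fun _ => id) le_rfl (by lia)) ?_ (by lia)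
  exact fun out hout => .pure
    ⟨⟨hout.node, hout.forest⟩, hout.grows_sets.union hout.grows_children, hout.substitutable⟩

end Insertion

/-! ### The stream -/

section Stream

variable {X ι U : Type}

/-- A bound on the number of elements that are stored in all trees together. -/
def storeBound (A : Setup X ι) : ℕ :=
  A.z * (nodeBound A * treeBound (nodeBound A) (A.z - 1))

/-- The memory that the streaming algorithm needs. -/
def streamBits (A : Setup X ι) : ℕ :=
  (A.z - 1) * (treeBound (nodeBound A) (A.z - 1) * nodeBits A) + A.elemBits + A.z +
    (workBits A + treeBound (nodeBound A) (A.z - 1) * (A.elemBits + 1))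

theorem one_le_nodeBound {A : Setup X ι} (hz : 1 ≤ A.z) : 1 ≤ nodeBound A :=
  Nat.mul_pos hz (one_le_guessBound _ _)

theorem one_le_storeBound {A : Setup X ι} (hz : 1 ≤ A.z) : 1 ≤ storeBound A :=
  Nat.mul_pos hz (Nat.mul_pos (one_le_nodeBound hz) (one_le_treeBound (one_le_nodeBound hz) _))

variable [DecidableEq X]

/-- The elements that are stored in the trees with the numbers `1, …, z - 1`. -/
def storedElems (A : Setup X ι) (F : ℕ → Tree X) : Finset X :=
  (Finset.Icc 1 (A.z - 1)).biUnion fun j => (F j).elems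

variable [DecidableEq ι] [DecidableEq U]

/-- The invariant of the trees `F` after the arrival of the elements `past`. -/
structure StreamInv (A : Setup X ι) (M : ι → Matroid X) (P : X → Finset U) (past : List X)
    (F : ℕ → Tree X) : Prop where
  tree : ∀ j, TreeInv A (indepOracle M) P j (F j)
  mem_past : ∀ j, ∀ x ∈ (F j).elems, x ∈ past
  substitutable : ∀ o ∈ past, Substitutable M P A.z o (storedElems A F)

variable {A : Setup X ι} {M : ι → Matroid X} {P : X → Finset U} {past : List X}
  {F : ℕ → Tree X} {e : X} {t : Tree X}

theorem streamInv_emptyTree (A : Setup X ι) (M : ι → Matroid X) (P : X → Finset U) :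
    StreamInv A M P [] fun _ => emptyTree A.z where
  tree := treeInv_emptyTree A (indepOracle M) P
  mem_past := by simp [emptyTree, Tree.elems, Forest.elems]
  substitutable := by simp

theorem StreamInv.discard (h : StreamInv A M P past F) (he : coverage P {e} = 0) :
    StreamInv A M P (e :: past) F where
  tree := h.tree
  mem_past j x hx := List.mem_cons_of_mem e (h.mem_past j x hx)
  substitutable := List.forall_mem_cons.2 ⟨.of_coverage_eq_zero he, h.substitutable⟩

theorem StreamInv.insert {v : ℕ} (h : StreamInv A M P past F)
    (ht : InsertSpec A M P v e (F v) t) (hv : v ∈ Finset.Icc 1 (A.z - 1)) :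
    StreamInv A M P (e :: past) (Function.update F v t) := by
  have hmono : storedElems A F ⊆ storedElems A (Function.update F v t) :=
    Finset.biUnion_mono fun j _ => by
      rcases eq_or_ne j v with rfl | hj
      · simpa using ht.grows.subset
      · rw [Function.update_of_ne hj]
  have hstored : t.elems ⊆ storedElems A (Function.update F v t) := by
    simpa [storedElems] using
      Finset.subset_biUnion_of_mem (fun j => (Function.update F v t j).elems) hv
  refine ⟨?_, ?_, List.forall_mem_cons.2 ⟨ht.substitutable.mono hstored,
    fun o ho => (h.substitutable o ho).mono hmono⟩⟩
  · exact (Function.forall_update_iff F fun j t => TreeInv A (indepOracle M) P j t).2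
      ⟨ht.tree, fun j _ => h.tree j⟩
  · refine (Function.forall_update_iff F fun _ t => ∀ x ∈ t.elems, x ∈ e :: past).2
      ⟨fun x hx => ?_, fun j _ x hx => List.mem_cons_of_mem e (h.mem_past j x hx)⟩
    exact List.mem_cons.2 ((Finset.mem_insert.1 (ht.grows.subset_insert hx)).imp_right
      (h.mem_past v x))

theorem StreamInv.treesBits_le (hA : ∀ e, (A.grounds e).length ≤ A.ℓ) (hz : 1 ≤ A.z)
    (h : StreamInv A M P past F) :
    treesBits A F ≤ (A.z - 1) * (treeBound (nodeBound A) (A.z - 1) * nodeBits A) := by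
  have hK := one_le_nodeBound hz
  simpa [treesBits] using Finset.sum_le_card_nsmul (Finset.Icc 1 (A.z - 1))
    (fun j => (F j).bits A.elemBits) _ fun j hj => ((h.tree j).bits_le hA hK).trans
      (Nat.mul_le_mul_right _ (treeBound_mono hK (Finset.mem_Icc.1 hj).2))

theorem StreamInv.card_storedElems_le (hA : ∀ e, (A.grounds e).length ≤ A.ℓ) (hz : 1 ≤ A.z)
    (h : StreamInv A M P past F) : (storedElems A F).card ≤ storeBound A := by
  have hK := one_le_nodeBound hz
  calc (storedElems A F).card
      ≤ (Finset.Icc 1 (A.z - 1)).card * (nodeBound A * treeBound (nodeBound A) (A.z - 1)) :=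
        Finset.card_biUnion_le_card_mul _ _ _ fun j hj => ((h.tree j).card_elems_le hA hK).trans
          (Nat.mul_le_mul_left _ (treeBound_mono hK (Finset.mem_Icc.1 hj).2))
    _ ≤ storeBound A := Nat.mul_le_mul_right _ (by simp)

theorem meets_insertElem_of_streamInv (hA : Presents A M) (h : StreamInv A M P past F)
    (he : e ∉ past) {v : ℕ} (hv : (P e).card = v) (hvz : v < A.z) :
    Meets (coverage P) (indepOracle M) (insertElem A e (F v)) (InsertSpec A M P v e (F v))
      (10 * storeBound A)
      (workBits A + treeBound (nodeBound A) (A.z - 1) * (A.elemBits + 1)) := by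
  have hz : 1 ≤ A.z := by lia
  have hK := one_le_nodeBound hz
  have hnodes : (F v).children.nodes + 1 ≤ treeBound (nodeBound A) (A.z - 1) :=
    ((h.tree v).nodes_lt_treeBound hA.length_grounds_le hK).trans
      (treeBound_mono hK (Nat.le_sub_one_of_lt hvz))
  have hstore : nodeBound A * ((F v).children.nodes + 1) ≤ storeBound A :=
    (Nat.mul_le_mul_left _ hnodes).trans (Nat.le_mul_of_pos_left _ hz)
  exact (meets_insertElem hA hz hvz.le hv (h.tree v) fun hmem => he (h.mem_past v e hmem)).mono
    (fun _ => id) (Nat.mul_le_mul_left 10 hstore)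
    (Nat.add_le_add_left (Nat.mul_le_mul_right _ hnodes) _)

theorem meets_streamFrom (hA : Presents A M) (hz : 1 ≤ A.z) (es : List X)
    (h : StreamInv A M P past F) (hnd : (es ++ past).Nodup) :
    Meets (coverage P) (indepOracle M) (streamFrom A es F)
      (fun R => (∃ e, A.z ≤ coverage P {e} ∧ R = {e}) ∨
        ∃ F', StreamInv A M P (es.reverse ++ past) F' ∧ R = storedElems A F')
      (es.length * (11 * storeBound A)) (streamBits A) := by
  induction es generalizing past F with
  | nil =>
    have hbits := h.treesBits_le hA.length_grounds_le hz
    exact .hold (.pure (.inr ⟨F, h, rfl⟩)) (b' := 0) (by rw [streamBits]; lia)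
  | cons e es ih =>
    have hnd' : (es ++ e :: past).Nodup := List.nodup_middle.2 hnd
    have he : e ∉ past := (List.nodup_cons.1 (List.nodup_append'.1 hnd').2.1).1
    have hbits := h.treesBits_le hA.length_grounds_le hz
    rw [List.reverse_cons, List.append_assoc, List.singleton_append, List.length_cons,
      Nat.succ_mul, Nat.add_comm]
    refine .bind (q₁ := 1) (q₂ := es.length * (11 * storeBound A) + 10 * storeBound A)
      (.hold (.value (post := (· = coverage P {e})) rfl le_rfl) (b' := 0)
        (by rw [streamBits]; lia)) ?_ (by have := one_le_storeBound hz; lia)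
    rintro v rfl
    split_ifs with hlarge hzero
    · exact .pure (.inl ⟨e, hlarge, rfl⟩)
    · exact (ih (h.discard hzero) hnd').mono (fun _ => id) (Nat.le_add_right _ _) le_rfl
    · have hsize := size_le_self (coverage P {e})
      refine .bind (.hold (meets_insertElem_of_streamInv hA h he
        (coverage_singleton P e).symm (not_le.1 hlarge)) (by rw [streamBits]; lia))
        (fun t ht => ih (h.insert ht (Finset.mem_Icc.2 (by lia))) hnd') (Nat.add_comm _ _).le

theorem meets_streamingCoverage (hA : Presents A M) (hz : 1 ≤ A.z) {stream : List X}
    (hnd : stream.Nodup) (hall : ∀ e, e ∈ stream) :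
    Meets (coverage P) (indepOracle M) (streamingCoverage A stream)
      (fun R => IsKernel M (coverage P) A.z R ∧ R.card ≤ storeBound A)
      (stream.length * (11 * storeBound A)) (streamBits A) := by
  refine (meets_streamFrom hA hz stream (streamInv_emptyTree A M P)
    (by rwa [List.append_nil])).mono ?_ le_rfl le_rfl
  rintro _ (⟨e, he, rfl⟩ | ⟨F, hF, rfl⟩)
  · exact ⟨fun _ => ⟨{e}, subset_rfl, hA.feasible_singleton e, he, hz⟩, one_le_storeBound hz⟩
  · exact ⟨isKernel_of_substitutable fun e => hF.substitutable e (by simpa using hall e),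
      hF.card_storedElems_le hA.length_grounds_le hz⟩

end Stream

/-! ### The constants -/

section Arithmetic

theorem choose_two_le_sq (m : ℕ) : (m + 1).choose 2 ≤ m ^ 2 := by
  have := Nat.le_self_pow two_ne_zero m
  rw [Nat.choose_two_right, Nat.add_sub_cancel]
  refine Nat.div_le_of_le_mul ?_
  lia

theorem add_choose_two_le_sq (m : ℕ) : m + 1 + (m + 1).choose 2 ≤ m ^ 2 + 2 := by
  induction m with
  | zero => norm_num
  | succ m ih =>
    rcases m with _ | m
    · decide
    · rw [Nat.choose_succ_succ' (m + 2), Nat.choose_one_right]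
      lia

theorem guessBound_one (d : ℕ) : guessBound 1 d = d + 1 := by simp [guessBound]

theorem guessBound_lt {ℓ : ℕ} (hℓ : 2 ≤ ℓ) (d : ℕ) : guessBound ℓ d < 2 * ℓ ^ d := by
  induction d with
  | zero => simp [guessBound]
  | succ d ih =>
    rw [guessBound_succ, pow_succ']
    have := Nat.mul_le_mul_left ℓ (Nat.succ_le_of_lt ih)
    lia

theorem lt_guessBound {ℓ : ℕ} (hℓ : 1 ≤ ℓ) (d : ℕ) : d < guessBound ℓ d := by
  rw [guessBound, ← Nat.succ_le_iff]
  simpa using Finset.card_nsmul_le_sum (Finset.range (d + 1)) (ℓ ^ ·) 1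
    fun i _ => Nat.one_le_pow i ℓ hℓ

theorem clog_le_two_mul_logb {n : ℕ} (hn : 2 ≤ n) : (Nat.clog 2 n : ℝ) ≤ 2 * Real.logb 2 n := by
  have hlog : 1 ≤ Real.logb 2 n := by
    rw [Real.le_logb_iff_rpow_le one_lt_two (by positivity), Real.rpow_one]
    exact_mod_cast hn
  have hceil := Nat.ceil_lt_add_one (zero_le_one.trans hlog)
  rw [← Nat.cast_ofNat, Real.natCeil_logb_natCast, Nat.cast_ofNat] at hceil
  linarith

theorem clog_le_clog_add {s n ℓ : ℕ} (h : s ≤ n * ℓ) : Nat.clog 2 s ≤ Nat.clog 2 n + ℓ := by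
  refine Nat.clog_le_of_le_pow (h.trans ?_)
  rw [pow_add]
  exact Nat.mul_le_mul (Nat.le_pow_clog one_lt_two n) Nat.lt_two_pow_self.le

end Arithmetic

section Constants

variable {X ι : Type} {A : Setup X ι}

theorem storeBound_eq (hz : 1 ≤ A.z) :
    storeBound A = 2 ^ A.z.choose 2 * setBound A ^ A.z * A.z ^ (A.z + 1) := by
  obtain ⟨m, hm⟩ := Nat.exists_eq_add_of_le' hz
  rw [storeBound, treeBound, nodeBound, hm, Nat.add_sub_cancel, mul_pow]
  ring

theorem storeBound_le (hz : 1 ≤ A.z) (hℓ : 1 ≤ A.ℓ) :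
    storeBound A ≤ 4 * kernelBound A.ℓ A.z := by
  rw [storeBound_eq hz, setBound, kernelBound]
  obtain ⟨m, hm⟩ := Nat.exists_eq_add_of_le' hz
  generalize A.ℓ = ℓ at *
  rw [hm, Nat.add_sub_cancel]
  split_ifs with h
  · subst h
    rw [guessBound_one, mul_one]
    calc 2 ^ (m + 1).choose 2 * (m + 1) ^ (m + 1) * (m + 1) ^ (m + 1 + 1)
        = 2 ^ (m + 1).choose 2 * (m + 1) ^ (2 * (m + 1) + 1) := by ring
      _ ≤ 2 ^ m ^ 2 * (m + 1) ^ (2 * (m + 1) + 1) := by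
        gcongr
        · exact one_le_two
        · exact choose_two_le_sq m
      _ ≤ 4 * (2 ^ m ^ 2 * (m + 1) ^ (2 * (m + 1) + 1)) := by lia
  · calc 2 ^ (m + 1).choose 2 * guessBound ℓ (m * ℓ) ^ (m + 1) * (m + 1) ^ (m + 1 + 1)
        ≤ 2 ^ (m + 1).choose 2 * (2 * ℓ ^ (m * ℓ)) ^ (m + 1) * (m + 1) ^ (m + 1 + 1) := by
          gcongr
          exact (guessBound_lt (by lia) _).le
      _ = 2 ^ (m + 1 + (m + 1).choose 2) * ℓ ^ ((m + 1) * m * ℓ) * (m + 1) ^ (m + 1 + 1) := by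
        rw [mul_pow, ← pow_mul, pow_add 2]
        ring
      _ ≤ 2 ^ (m ^ 2 + 2) * ℓ ^ ((m + 1) * m * ℓ) * (m + 1) ^ (m + 1 + 1) := by
        refine Nat.mul_le_mul_right _ (Nat.mul_le_mul_right _ ?_)
        exact Nat.pow_le_pow_right two_pos (add_choose_two_le_sq m)
      _ = 4 * (2 ^ m ^ 2 * ℓ ^ ((m + 1) * m * ℓ) * (m + 1) ^ (m + 1 + 1)) := by ring

theorem setBound_le_nodeBound (hz : 1 ≤ A.z) : setBound A ≤ nodeBound A :=
  Nat.le_mul_of_pos_left _ hz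

theorem nodeBits_le (hz : 1 ≤ A.z) (hb : 1 ≤ A.elemBits) :
    nodeBits A ≤ 6 * (nodeBound A * A.elemBits) := by
  have hK := one_le_nodeBound hz
  have hzK : A.z ≤ nodeBound A := Nat.le_mul_of_pos_right _ (one_le_guessBound _ _)
  have hKb := Nat.le_mul_of_pos_right (nodeBound A) hb
  have hbK := Nat.le_mul_of_pos_left A.elemBits hK
  rw [nodeBits]
  lia

theorem setBound_le_treeBound (hz : 1 ≤ A.z) :
    setBound A ≤ treeBound (nodeBound A) (A.z - 1) := by
  have hK := one_le_nodeBound hz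
  rcases hz.eq_or_lt with h | h
  · simp [setBound, guessBound, treeBound, ← h]
  · calc setBound A ≤ nodeBound A := setBound_le_nodeBound hz
      _ ≤ treeBound (nodeBound A) 1 := by
        simpa [treeBound] using Nat.le_mul_of_pos_right _ two_pos
      _ ≤ treeBound (nodeBound A) (A.z - 1) := treeBound_mono hK (Nat.le_sub_one_of_lt h)

theorem guessBits_le (hz : 2 ≤ A.z) (hℓ : 1 ≤ A.ℓ) (hb : 1 ≤ A.elemBits)
    (hib : A.indexBits ≤ A.elemBits + A.ℓ) :
    guessBits A ((A.z - 1) * A.ℓ) (setBound A + 1) ≤ 7 * (setBound A * A.elemBits) := by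
  have hD : (A.z - 1) * A.ℓ < setBound A := lt_guessBound hℓ _
  have hℓD : A.ℓ ≤ (A.z - 1) * A.ℓ := Nat.le_mul_of_pos_left _ (Nat.le_sub_one_of_lt hz)
  have hS := Nat.le_mul_of_pos_right (setBound A) hb
  have hDb := Nat.mul_le_mul_right A.elemBits (Nat.succ_le_of_lt hD)
  rw [guessBits, ← setBound]
  lia

theorem repBits_le (hz : 1 ≤ A.z) (hℓ : 1 ≤ A.ℓ) (hb : 1 ≤ A.elemBits)
    (hib : A.indexBits ≤ A.elemBits + A.ℓ) :
    repBits A (setBound A + 1) ≤ 8 * (storeBound A * A.elemBits) := by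
  have hstore := Nat.le_mul_of_pos_left A.elemBits (one_le_storeBound hz)
  rcases hz.eq_or_lt with h | h
  · rw [repBits, ← h]
    lia
  · have hD : (A.z - 1) * A.ℓ ≤ nodeBound A :=
      (lt_guessBound hℓ _).le.trans (setBound_le_nodeBound hz)
    calc repBits A (setBound A + 1)
        ≤ nodeBound A * (7 * (treeBound (nodeBound A) (A.z - 1) * A.elemBits)) + A.elemBits := by
          rw [repBits]
          gcongr
          exact (guessBits_le h hℓ hb hib).trans (by gcongr; exact setBound_le_treeBound hz)
      _ = 7 * (nodeBound A * treeBound (nodeBound A) (A.z - 1) * A.elemBits) + A.elemBits := by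
          ring
      _ ≤ 7 * (storeBound A * A.elemBits) + storeBound A * A.elemBits := by
          gcongr
          exact Nat.le_mul_of_pos_left _ hz
      _ = 8 * (storeBound A * A.elemBits) := by ring

theorem streamBits_le (hz : 1 ≤ A.z) (hℓ : 1 ≤ A.ℓ) (hb : 1 ≤ A.elemBits)
    (hib : A.indexBits ≤ A.elemBits + A.ℓ) : streamBits A ≤ 32 * (storeBound A * A.elemBits) := by
  have hrep := repBits_le hz hℓ hb hib
  have hK := one_le_nodeBound hz
  set K := nodeBound A
  set T := treeBound K (A.z - 1)
  have hT : 1 ≤ T := one_le_treeBound hK _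
  have hzS : A.z ≤ storeBound A := Nat.le_mul_of_pos_right _ (Nat.mul_pos hK hT)
  have hKS : K ≤ storeBound A :=
    (Nat.le_mul_of_pos_right K hT).trans (Nat.le_mul_of_pos_left _ hz)
  have hTS : T ≤ storeBound A :=
    (Nat.le_mul_of_pos_left T hK).trans (Nat.le_mul_of_pos_left _ hz)
  have htrees : (A.z - 1) * (T * nodeBits A) ≤ 6 * (storeBound A * A.elemBits) :=
    calc (A.z - 1) * (T * nodeBits A) ≤ A.z * (T * (6 * (K * A.elemBits))) :=
          Nat.mul_le_mul (Nat.sub_le _ _) (Nat.mul_le_mul_left T (nodeBits_le hz hb))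
      _ = 6 * (A.z * (K * T) * A.elemBits) := by ring
  have hsets : setBound A * A.elemBits ≤ storeBound A * A.elemBits :=
    Nat.mul_le_mul_right _ ((setBound_le_nodeBound hz).trans hKS)
  have hpath : T * A.elemBits ≤ storeBound A * A.elemBits := Nat.mul_le_mul_right _ hTS
  have hone : storeBound A ≤ storeBound A * A.elemBits := Nat.le_mul_of_pos_right _ hb
  have hbits : A.elemBits ≤ storeBound A * A.elemBits :=
    Nat.le_mul_of_pos_left _ (one_le_storeBound hz)
  rw [streamBits, workBits, compareBits]
  lia

theorem streamBits_stdSetup_le [Fintype X] [Fintype ι] {ℓ z : ℕ} (hz : 1 ≤ z) (hℓ : 1 ≤ ℓ)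
    (grounds : X → List ι) (hX : 2 ≤ Fintype.card X)
    (hι : Fintype.card ι ≤ Fintype.card X * ℓ) :
    (streamBits (stdSetup ℓ z grounds) : ℝ) ≤
      256 * (kernelBound ℓ z * Real.logb 2 (Fintype.card X)) := by
  set A := stdSetup ℓ z grounds
  have hbits : streamBits A ≤ 32 * (storeBound A * A.elemBits) :=
    streamBits_le hz hℓ (Nat.clog_pos one_lt_two hX) (clog_le_clog_add hι)
  calc (streamBits A : ℝ) ≤ 32 * (storeBound A * A.elemBits) := by exact_mod_cast hbits
    _ ≤ 32 * (4 * kernelBound ℓ z * (2 * Real.logb 2 (Fintype.card X))) := by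
        gcongr
        · exact_mod_cast storeBound_le (A := A) hz hℓ
        · exact clog_le_two_mul_logb hX
    _ = 256 * (kernelBound ℓ z * Real.logb 2 (Fintype.card X)) := by ring

end Constants

end Coverage

theorem theorem4 :
    ∃ C : ℝ, 0 < C ∧
      ∀ (X ι : Type) [Fintype X] [DecidableEq X] [Fintype ι] [DecidableEq ι]
        (ℓ z : ℕ) (_ : 1 ≤ ℓ) (_ : 1 ≤ z)
        (M : ι → Matroid X) (_ : IsMatchoid ℓ M)
        (_ : ∀ e : X, Feasible M {e})
        (f : Finset X → ℕ) (_ : IsUnweightedCoverage f)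
        (grounds : X → List ι) (_ : ∀ e, (grounds e).Nodup)
        (_ : ∀ e i, i ∈ grounds e ↔ e ∈ (M i).E)
        (stream : List X) (_ : stream.Nodup) (_ : ∀ e : X, e ∈ stream)
        (A : Coverage.Setup X ι) (_ : A = Coverage.stdSetup ℓ z grounds)
        (I : ι → Finset X → Bool) (_ : I = Coverage.indepOracle M)
        (R : Finset X) (_ : R = (Coverage.streamingCoverage A stream).eval f I),
        (∀ (T : List X) (w : X → ℝ), T.Pairwise (fun a b => w b < w a) →
          IsJointRepSet M z T.toFinset w ((Coverage.repSet A T).eval f I)) ∧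
        IsKernel M f z R ∧
        (R.card : ℝ) ≤ C * Coverage.kernelBound ℓ z ∧
        (2 ≤ Fintype.card X → Fintype.card ι ≤ Fintype.card X * ℓ →
          ((Coverage.streamingCoverage A stream).peakBits f I : ℝ) ≤
            C * (Coverage.kernelBound ℓ z * Real.logb 2 (Fintype.card X))) ∧
        ((Coverage.streamingCoverage A stream).valueQueries f I : ℝ) ≤
          C * (Coverage.kernelBound ℓ z * Fintype.card X) := by
  refine ⟨256, by norm_num, ?_⟩
  rintro X ι _ _ _ _ ℓ z hℓ hz M hM hsingle f ⟨U, _, _, P, hf⟩ grounds hgnd hg stream hnd hall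
    A hA I rfl R rfl
  obtain rfl : f = Coverage.coverage P := funext hf
  have hpres : Coverage.Presents A M := hA ▸ ⟨hM, hg, hgnd, hsingle⟩
  obtain rfl : z = A.z := hA ▸ rfl
  obtain rfl : ℓ = A.ℓ := hA ▸ rfl
  have hrun := Coverage.meets_streamingCoverage (P := P) hpres hz hnd hall
  have hstore : (Coverage.storeBound A : ℝ) ≤ 4 * Coverage.kernelBound A.ℓ A.z := by
    exact_mod_cast Coverage.storeBound_le hz hℓ
  refine ⟨fun T w hw => ?_, hrun.eval.1, ?_, fun hX hι => ?_, ?_⟩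
  · exact (Coverage.meets_repSet A (Coverage.coverage P) _ hpres.length_grounds_le le_rfl).eval ▸
      Coverage.isJointRepSet_repFinset hpres (hw.imp le_of_lt)
  · exact (Nat.cast_le.2 hrun.eval.2).trans (hstore.trans (by gcongr; norm_num))
  · have hbits := Coverage.streamBits_stdSetup_le hz hℓ grounds hX hι
    exact (Nat.cast_le.2 hrun.peakBits_le).trans (hA ▸ hbits)
  · calc _ ≤ (Fintype.card X * (11 * Coverage.storeBound A) : ℝ) := by
          exact_mod_cast hrun.valueQueries_le.trans (Nat.mul_le_mul_right _ hnd.length_le_card)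
      _ ≤ Fintype.card X * (11 * (4 * Coverage.kernelBound A.ℓ A.z)) := by gcongr
      _ = 44 * (Coverage.kernelBound A.ℓ A.z * Fintype.card X) := by ring
      _ ≤ _ := by gcongr; norm_num
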